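/- Conventions. A metric space is proper if all its closed balls are compact. Let $X$ be a proper metric space with base point $x_0$ (nothing below depends on its choice; the empty space is regarded as bounded), and let $B_r(x)$ be the open ball of radius $r$ about $x$. Two sets $A,B\subset X$ are *asymptotically disjoint* if $\lim_{r\to\infty}d(A\setminus B_r(x_0),B\setminus B_r(x_0))=\infty$. A function $\phi:X\to[0,1]$ is *slowly oscillating* if for all $r,\varepsilon>0$ there is $D>0$ such that $\operatorname{diam}\phi(B_r(x))<\varepsilon$ whenever $d(x,x_0)\ge D$. Let $C_h(X)$ be the set of all continuous slowly oscillating functions $X\to[0,1]$; the *Higson compactification* $cX$ is the closure of the image of $X$ under the embedding $\Phi:X\to[0,1]^{C_h(X)}$, $\Phi(x)=(\phi(x))_{\phi\in C_h(X)}$, and the *Higson corona* is $\nu X=cX\setminus X$. For $C\subset X$ let $C'=\operatorname{cl}C\cap\nu X$, the closure being taken in $cX$. A closed set $C\subset X$ is an *asymptotic separator* for asymptotically disjoint sets $A,B\subset X$ if $C'$ is a partition between $A'$ and $B'$ in $\nu X$, i.e. $\nu X\setminus C'=U_1\cup U_2$ for some disjoint open sets $U_1\supset A'$ and $U_2\supset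 B'$ of $\nu X$. Define $\operatorname{asInd}X=-1$ if and only if $X$ is bounded; for an integer $n\ge 0$, $\operatorname{asInd}X\le n$ if every two asymptotically disjoint sets $A,B\subset X$ have an asymptotic separator $C$ with $\operatorname{asInd}C\le n-1$ (where $C$ carries the restricted metric); $\operatorname{asInd}X$ is the least such $n$ if $X$ is unbounded, and $\infty$ if there is none. Its transfinite extension is defined by $\operatorname{trasInd}X=-1$ if and only if $X$ is bounded; for an ordinal $\alpha$, $\operatorname{trasInd}X\le\alpha$ if every two asymptotically disjoint sets $A,B\subset X$ have an asymptotic separator $C$ with $\operatorname{trasInd}C\le\beta$ for some $\beta<\alpha$ ($\beta=-1$ is allowed); $\operatorname{trasInd}X$ is the least such $\alpha$ if $X$ is unbounded, and $\infty$ if there is none. Theorem 5. Let $X$ be a proper metric space such that $\operatorname{trasInd}X<\infty$. Then $\operatorname{asInd}X<\infty$. (That is, the transfinite extension $\operatorname{trasInd}$ of $\operatorname{asInd}$ is trivial.) -/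

import Mathlib

universe u

/-- `C` is a partition between `A₁` and `A₂` in the topological space `T`: the complement of `C` is
the union of two disjoint open sets, one containing `A₁` and the other one `A₂`. -/
def IsPartition {T : Type*} [TopologicalSpace T] (A₁ A₂ C : Set T) : Prop :=
  ∃ U₁ U₂ : Set T, IsOpen U₁ ∧ IsOpen U₂ ∧ Disjoint U₁ U₂ ∧ Cᶜ = U₁ ∪ U₂ ∧ A₁ ⊆ U₁ ∧ A₂ ⊆ U₂

/-- `A₁` and `A₂` are asymptotically disjoint: `d (A₁ \ B_r(x₀), A₂ \ B_r(x₀)) → ∞` as `r → ∞`.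
Bounded sets replace the balls around a base point, so that no base point has to be chosen (and the
empty space is covered); for any base point this is the same condition. -/
def AsymptoticallyDisjoint {X : Type*} [MetricSpace X] (A₁ A₂ : Set X) : Prop :=
  ∀ M : ℝ, ∃ K : Set X, Bornology.IsBounded K ∧ ∀ a ∈ A₁ \ K, ∀ b ∈ A₂ \ K, M ≤ dist a b

/-- `φ : X → [0, 1]` is slowly oscillating: for all `r, ε > 0` the diameter of `φ (B_r(x))` is less
than `ε` for all `x` outside of some bounded set. -/
def IsSlowlyOscillating {X : Type*} [MetricSpace X] (φ : X → unitInterval) : Prop :=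
  ∀ r > (0 : ℝ), ∀ ε > (0 : ℝ), ∃ K : Set X, Bornology.IsBounded K ∧
    ∀ x ∉ K, Metric.diam (φ '' Metric.ball x r) < ε

/-- The set `C_h(X)` of all continuous slowly oscillating functions `X → [0, 1]`. -/
def HigsonFunction (X : Type*) [MetricSpace X] : Type _ :=
  {φ : C(X, unitInterval) // IsSlowlyOscillating φ}

/-- The map `Φ : X → [0, 1] ^ C_h(X)`, `Φ x = (φ x)_φ`; the target carries the product topology. -/
def higsonMap (X : Type*) [MetricSpace X] (x : X) : HigsonFunction X → unitInterval :=
  fun φ => φ.1 x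

/-- The Higson compactification `cX`: the closure of `Φ(X)` in `[0, 1] ^ C_h(X)`. -/
def higsonCompactification (X : Type*) [MetricSpace X] : Set (HigsonFunction X → unitInterval) :=
  closure (Set.range (higsonMap X))

/-- The Higson corona `νX = cX \ X`. -/
def higsonCorona (X : Type*) [MetricSpace X] : Set (HigsonFunction X → unitInterval) :=
  higsonCompactification X \ Set.range (higsonMap X)

/-- The trace `C' = cl C ∩ νX` of `C ⊆ X` in the Higson corona, as a subset of the space `νX`. -/
def coronaTrace {X : Type*} [MetricSpace X] (C : Set X) : Set (higsonCorona X) :=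
  {p | (p : HigsonFunction X → unitInterval) ∈ closure (higsonMap X '' C)}

/-- `C` is an asymptotic separator for `A₁` and `A₂`: it is closed in `X`, and its trace is a
partition between the traces of `A₁` and `A₂` in the Higson corona. -/
def IsAsymptoticSeparator {X : Type*} [MetricSpace X] (A₁ A₂ C : Set X) : Prop :=
  IsClosed C ∧ IsPartition (coronaTrace A₁) (coronaTrace A₂) (coronaTrace C)

/-- `AsIndLE n X` is the relation `asInd X ≤ n` for `n = 0, 1, 2, …`. The relation `asInd C ≤ -1`
means that `C` is bounded. A subset is regarded as a metric space with the restricted metric. -/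
def AsIndLE : ℕ → ∀ (X : Type u) [MetricSpace X], Prop
  | 0, X, _ => ∀ A B : Set X, AsymptoticallyDisjoint A B →
      ∃ C : Set X, IsAsymptoticSeparator A B C ∧ BoundedSpace C
  | n + 1, X, _ => ∀ A B : Set X, AsymptoticallyDisjoint A B →
      ∃ C : Set X, IsAsymptoticSeparator A B C ∧ AsIndLE n C

/-- `TrasIndLE α X` is the relation `trasInd X ≤ α` for an ordinal number `α`: every two
asymptotically disjoint sets have an asymptotic separator `C` with `trasInd C ≤ β` for some
`β < α`. Here `β` is either `-1`, and then `C` is bounded, or an ordinal number. -/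
def TrasIndLE (α : Ordinal.{u}) (X : Type u) [MetricSpace X] : Prop :=
  ∀ A B : Set X, AsymptoticallyDisjoint A B →
    ∃ C : Set X, IsAsymptoticSeparator A B C ∧
      (BoundedSpace C ∨ ∃ β : Ordinal.{u}, ∃ _ : β < α, TrasIndLE β C)
termination_by α

open Classical in
/-- The asymptotic large inductive dimension: `⊥` stands for `-1`, and `⊤` for `∞`. -/
noncomputable def asInd (X : Type u) [MetricSpace X] : WithBot (WithTop ℕ) :=
  if BoundedSpace X then ⊥
  else ((sInf {d : WithTop ℕ | ∃ n : ℕ, d = n ∧ AsIndLE n X} : WithTop ℕ) : WithBot (WithTop ℕ))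

open Classical in
/-- The transfinite extension of `asInd`: `⊥` stands for `-1`, and `⊤` for `∞`. Ordinals of the
universe of `X` suffice, as all separators are subsets of `X`. -/
noncomputable def trasInd (X : Type u) [MetricSpace X] : WithBot (WithTop Ordinal.{u}) :=
  if BoundedSpace X then ⊥
  else ((sInf {d : WithTop Ordinal.{u} | ∃ α : Ordinal.{u}, d = (α : WithTop Ordinal.{u}) ∧
    TrasIndLE α X} : WithTop Ordinal.{u}) : WithBot (WithTop Ordinal.{u}))

/-! The transfinite extension adds nothing because the dimension and the control of separators can
be made uniform over all pairs of sets. By an ultrafilter argument with chains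
(`IsAsymptoticSeparator.false_of_paths`), an asymptotic separator `C` separates at every scale `r`:
outside a ball and a neighbourhood of `C`, both with radii depending on `r`, the two sides are
`r`-far apart. `ScaleDimLT` iterates this finitely often, with one control function `γ` and scales
bounded by `R`.

By transfinite induction, each separator has some `n` and `γ` that serve its bounded subsets far
out, but these depend on the pair. A Baire category argument (`PairPattern.exists_dense`) removes
the dependence. There are only countably many choices of a dimension and an initial segment of `γ`,
so a generic pair supplies one `n` and one `γ` such that, for each `R`, the pairs with dimension `n`
and a control agreeing with `γ` up to `R` are dense below some pattern. A bounded pair that is far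
out and far enough apart can be grafted onto this pattern, and so inherits the bounds
(`exists_scaleDimLT_of_hasScaleSeparator`).

Conversely, uniform bounds give finite `asInd`. Along a fast growing sequence of scales, a pair is
enlarged from coarse to fine inside finite sets, and an ultralimit gives sets `U i`, `V i` on the
whole space (`AsymptoticallyNearControlled.exists_levels`). A net of increasing sparsity in the
uncovered points is a separator. At each scale of the sequence, it is, up to isolated points and far
out, near sets of smaller scale dimension, so the construction repeats on it until the separator is
empty. -/

/-! ### Dimension at bounded scales -/

/-- All distances between points of `A` and points of `B` exceed `s`. -/
def FarApart {X : Type*} [MetricSpace X] (s : ℕ) (A B : Set X) : Prop :=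
  ∀ a ∈ A, ∀ b ∈ B, (s : ℝ) < dist a b

/-- `ScaleDimLT n γ R K`: at all scales up to `R`, the subset `K` of `X` has large inductive
dimension less than `n`, controlled by the function `γ`. The separators need not lie in `K`. -/
def ScaleDimLT {X : Type*} [MetricSpace X] : ℕ → (ℕ → ℕ) → ℕ → Set X → Prop
  | 0, _, _, K => K = ∅
  | n + 1, γ, R, K => ∀ R' ≤ R, ∀ A ⊆ K, ∀ B ⊆ K, FarApart (γ R') A B →
      ∃ C : Set X, ScaleDimLT n γ R' C ∧ ∀ r ≤ R', ∃ U V : Set X, A ⊆ U ∧ B ⊆ V ∧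
        FarApart r U V ∧ ∀ x ∈ K, x ∈ U ∨ x ∈ V ∨ ∃ c ∈ C, dist x c ≤ γ r

section
variable {X : Type*} [MetricSpace X]

lemma FarApart.mono {s t : ℕ} {A B A' B' : Set X} (h : FarApart s A B) (hst : t ≤ s)
    (hA : A' ⊆ A) (hB : B' ⊆ B) : FarApart t A' B' := fun a ha b hb =>
  lt_of_le_of_lt (Nat.cast_le.2 hst) (h a (hA ha) b (hB hb))

lemma FarApart.disjoint {s : ℕ} {A B : Set X} (h : FarApart s A B) : Disjoint A B := by
  rw [Set.disjoint_left]
  intro x ha hb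
  have := h x ha x hb
  rw [dist_self] at this
  exact absurd this (not_lt.2 (Nat.cast_nonneg s))

/-- Enlarging the control only weakens the condition: it asks for more separation of the given pair
and allows larger neighbourhoods of the separator. -/
lemma ScaleDimLT.mono {n : ℕ} {γ γ' : ℕ → ℕ} {R R' : ℕ} {K K' : Set X}
    (h : ScaleDimLT n γ R K) (hR : R' ≤ R) (hγ : ∀ r ≤ R', γ r ≤ γ' r) (hK : K' ⊆ K) :
    ScaleDimLT n γ' R' K' := by
  induction n generalizing R R' K K' with
  | zero => exact Set.subset_eq_empty hK h
  | succ n ih =>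
    intro S hS A hA B hB hAB
    obtain ⟨C, hC, h2⟩ := h S (hS.trans hR) A (hA.trans hK) B (hB.trans hK)
      (hAB.mono (hγ S hS) le_rfl le_rfl)
    refine ⟨C, ih hC le_rfl (fun r hr => hγ r (hr.trans hS)) le_rfl, fun r hr => ?_⟩
    obtain ⟨U, V, hU, hV, hUV, hcov⟩ := h2 r hr
    refine ⟨U, V, hU, hV, hUV, fun x hx => ?_⟩
    rcases hcov x (hK hx) with h | h | ⟨c, hc, hd⟩
    · exact Or.inl h
    · exact Or.inr (Or.inl h)
    · exact Or.inr (Or.inr ⟨c, hc, hd.trans (Nat.cast_le.2 (hγ r (hr.trans hS)))⟩)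

lemma ScaleDimLT.succ {n : ℕ} {γ : ℕ → ℕ} {R : ℕ} {K : Set X} (h : ScaleDimLT n γ R K) :
    ScaleDimLT (n + 1) γ R K := by
  induction n generalizing R K with
  | zero =>
    have hK : K = ∅ := h
    subst hK
    intro S _ A hA B hB hAB
    refine ⟨∅, rfl, fun r _ => ⟨∅, ∅, hA, hB, fun a ha => ha.elim, fun x hx => hx.elim⟩⟩
  | succ n ih =>
    intro S hS A hA B hB hAB
    obtain ⟨C, hC, h2⟩ := h S hS A hA B hB hAB
    exact ⟨C, ih hC, h2⟩

/-- Transports bounds found inside a separator, viewed as a space of its own, to the ambient space.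
-/
lemma ScaleDimLT.image {Y : Type*} [MetricSpace Y] {f : Y → X} (hf : Isometry f) {n : ℕ}
    {γ : ℕ → ℕ} {R : ℕ} {K : Set Y} (h : ScaleDimLT n γ R K) : ScaleDimLT n γ R (f '' K) := by
  induction n generalizing R K with
  | zero => exact Set.image_eq_empty.2 h
  | succ n ih =>
    intro S hS A hA B hB hAB
    obtain ⟨A, hA', rfl⟩ := Set.subset_image_iff.1 hA
    obtain ⟨B, hB', rfl⟩ := Set.subset_image_iff.1 hB
    obtain ⟨C, hC, h2⟩ := h S hS A hA' B hB' (fun a ha b hb => by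
      rw [← hf.dist_eq]
      exact hAB _ (Set.mem_image_of_mem f ha) _ (Set.mem_image_of_mem f hb))
    refine ⟨f '' C, ih hC, fun r hr => ?_⟩
    obtain ⟨U, V, hU, hV, hUV, hcov⟩ := h2 r hr
    refine ⟨f '' U, f '' V, Set.image_mono hU, Set.image_mono hV, ?_, ?_⟩
    · rintro _ ⟨a, ha, rfl⟩ _ ⟨b, hb, rfl⟩
      rw [hf.dist_eq]
      exact hUV a ha b hb
    · rintro _ ⟨x, hx, rfl⟩
      rcases hcov x hx with h | h | ⟨c, hc, hd⟩
      · exact Or.inl (Set.mem_image_of_mem f h)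
      · exact Or.inr (Or.inl (Set.mem_image_of_mem f h))
      · exact Or.inr (Or.inr ⟨f c, Set.mem_image_of_mem f hc, by rwa [hf.dist_eq]⟩)

end

/-! ### Slowly oscillating functions and the Higson corona -/

section
variable {X : Type*} [MetricSpace X]
open Bornology Filter Topology

lemma IsSlowlyOscillating.dist_lt {φ : X → unitInterval} (hφ : IsSlowlyOscillating φ) {r ε : ℝ}
    (hε : 0 < ε) : ∃ K : Set X, IsBounded K ∧ ∀ x ∉ K, ∀ y, dist x y ≤ r → dist (φ x) (φ y) < ε := by
  obtain ⟨K, hK, h⟩ := hφ (max r 0 + 1) (by positivity) ε hε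
  refine ⟨K, hK, fun x hx y hy => lt_of_le_of_lt ?_ (h x hx)⟩
  refine Metric.dist_le_diam_of_mem ?_ (Set.mem_image_of_mem _ ?_) (Set.mem_image_of_mem _ ?_)
  · exact Metric.isBounded_of_compactSpace
  · simp only [Metric.mem_ball, dist_self]; positivity
  · rw [Metric.mem_ball, dist_comm]
    have := le_max_left r 0
    linarith

/-- If every two points of a ball of radius `r` far out have `φ`-distance at most `ε`, then `φ` is
slowly oscillating. -/
lemma isSlowlyOscillating_of_dist_le {φ : X → unitInterval}
    (h : ∀ r > (0 : ℝ), ∀ ε > (0 : ℝ), ∃ K : Set X, IsBounded K ∧ ∀ x ∉ K, ∀ y, dist x y < r →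
      dist (φ x) (φ y) ≤ ε) : IsSlowlyOscillating φ := by
  intro r hr ε hε
  obtain ⟨K, hK, hd⟩ := h r hr (ε / 4) (by positivity)
  refine ⟨K, hK, fun x hx => lt_of_le_of_lt (b := ε / 2) ?_ (by linarith)⟩
  refine Metric.diam_le_of_forall_dist_le (by positivity) ?_
  rintro _ ⟨y, hy, rfl⟩ _ ⟨z, hz, rfl⟩
  rw [Metric.mem_ball, dist_comm] at hy hz
  have h1 := hd x hx y hy
  have h2 := hd x hx z hz
  have := dist_triangle_left (φ y) (φ z) (φ x)
  linarith

/-- A continuous slowly oscillating function that is positive at `x` only near `x`. -/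
lemma exists_higsonFunction_bump (x : X) : ∃ φ : HigsonFunction X, φ.1 x = 1 ∧
    ∀ y, 1 ≤ dist x y → φ.1 y = 0 := by
  have hm : ∀ y, max 0 (1 - dist x y) ∈ unitInterval := fun y =>
    ⟨le_max_left _ _, max_le zero_le_one (by linarith [dist_nonneg (x := x) (y := y)])⟩
  let f : C(X, unitInterval) := ⟨fun y => ⟨max 0 (1 - dist x y), hm y⟩, by fun_prop⟩
  have hf : ∀ y, 1 ≤ dist x y → f y = 0 := fun y hy => by
    apply Subtype.ext
    change max 0 (1 - dist x y) = 0
    exact max_eq_left (by linarith)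
  refine ⟨⟨f, isSlowlyOscillating_of_dist_le fun r hr ε hε => ?_⟩, ?_, hf⟩
  · refine ⟨Metric.ball x (1 + r), Metric.isBounded_ball, fun y hy z hz => ?_⟩
    rw [Metric.mem_ball, not_lt, dist_comm] at hy
    rw [hf y (by linarith), hf z (by linarith [dist_triangle_right x y z]), dist_self]
    exact hε.le
  · apply Subtype.ext
    change max 0 (1 - dist x x) = 1
    simp

/-- The numerator contributes `r` and the denominator `2 * r`, the latter weighted by `b / T ≤ 1`.
This is the slow oscillation estimate for a quotient of distance functions. -/
lemma abs_div_sub_div_le {a b S T r M : ℝ} (hb : 0 ≤ b) (hbT : b ≤ T)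
    (hab : |a - b| ≤ r) (hST : |S - T| ≤ 2 * r) (hM : 0 < M) (hS : M ≤ S) (hT : M ≤ T) :
    |a / S - b / T| ≤ 3 * r / M := by
  have hS0 : 0 < S := hM.trans_le hS
  have hT0 : 0 < T := hM.trans_le hT
  have e : a / S - b / T = ((a - b) + b / T * (T - S)) / S := by field_simp; ring
  have hq : b / T ≤ 1 := (div_le_one hT0).2 hbT
  have hq0 : 0 ≤ b / T := div_nonneg hb hT0.le
  have hr : 0 ≤ r := (abs_nonneg _).trans hab
  rw [e, abs_div, abs_of_pos hS0]
  refine div_le_div₀ (by positivity) ?_ hM hS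
  calc |a - b + b / T * (T - S)| ≤ |a - b| + |b / T * (T - S)| := abs_add_le _ _
    _ ≤ r + 1 * (2 * r) := by
        rw [abs_mul, abs_of_nonneg hq0, abs_sub_comm T S]
        exact add_le_add hab (mul_le_mul hq hST (abs_nonneg _) zero_le_one)
    _ = 3 * r := by ring

/-- Such an `x` has points of `D` and `E` nearby at a mutual distance less than `M`; one of them
lies in the exceptional bounded set, and `x` is within `M` of it. -/
lemma AsymptoticallyDisjoint.isBounded_infDist_add_lt {D E : Set X}
    (h : AsymptoticallyDisjoint D E) (hD : D.Nonempty) (hE : E.Nonempty) (M : ℝ) :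
    IsBounded {x | Metric.infDist x D + Metric.infDist x E < M} := by
  obtain ⟨K, hK, hd⟩ := h M
  refine (hK.thickening (δ := M)).subset fun x hx => ?_
  obtain ⟨η, hη, hx'⟩ : ∃ η > 0, Metric.infDist x D + η + (Metric.infDist x E + η) < M := by
    have hx : Metric.infDist x D + Metric.infDist x E < M := hx
    exact ⟨(M - (Metric.infDist x D + Metric.infDist x E)) / 4, by linarith, by linarith⟩
  obtain ⟨a, ha, ha'⟩ := (Metric.infDist_lt_iff hD).1 (lt_add_of_pos_right (Metric.infDist x D) hη)
  obtain ⟨b, hb, hb'⟩ := (Metric.infDist_lt_iff hE).1 (lt_add_of_pos_right (Metric.infDist x E) hη)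
  rw [Metric.mem_thickening_iff]
  by_contra! hcon
  have h1 := hd a ⟨ha, fun haK => by
    linarith [hcon a haK, Metric.infDist_nonneg (x := x) (s := E)]⟩ b ⟨hb, fun hbK => by
    linarith [hcon b hbK, Metric.infDist_nonneg (x := x) (s := D)]⟩
  linarith [dist_triangle_left a b x]

/-- Asymptotically disjoint sets are separated by a continuous slowly oscillating function. -/
lemma AsymptoticallyDisjoint.exists_higsonFunction {D E : Set X}
    (h : AsymptoticallyDisjoint D E) : ∃ φ : HigsonFunction X, ∃ K : Set X, IsBounded K ∧
      (∀ x ∈ D \ K, φ.1 x = 0) ∧ ∀ x ∈ E \ K, φ.1 x = 1 := by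
  have hconst : ∀ t : unitInterval, IsSlowlyOscillating (fun _ : X => t) := fun t =>
    isSlowlyOscillating_of_dist_le fun r _ ε hε => ⟨∅, isBounded_empty, fun x _ y _ => by
      rw [dist_self]; exact hε.le⟩
  rcases D.eq_empty_or_nonempty with rfl | hD
  · exact ⟨⟨ContinuousMap.const X 1, hconst 1⟩, ∅, isBounded_empty, by simp, by simp⟩
  rcases E.eq_empty_or_nonempty with rfl | hE
  · exact ⟨⟨ContinuousMap.const X 0, hconst 0⟩, ∅, isBounded_empty, by simp, by simp⟩
  set u : X → ℝ := fun x => Metric.infDist x D with hu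
  set v : X → ℝ := fun x => Metric.infDist x E with hv
  have hu0 : ∀ x, 0 ≤ u x := fun x => Metric.infDist_nonneg
  have hv0 : ∀ x, 0 ≤ v x := fun x => Metric.infDist_nonneg
  have huL : ∀ x y, |u x - u y| ≤ dist x y := fun x y => by
    simpa [Real.dist_eq] using (Metric.lipschitz_infDist_pt D).dist_le_mul x y
  have hvL : ∀ x y, |v x - v y| ≤ dist x y := fun x y => by
    simpa [Real.dist_eq] using (Metric.lipschitz_infDist_pt E).dist_le_mul x y
  have hbd := h.isBounded_infDist_add_lt hD hE
  -- Urysohn's quotient, with the denominator cut off at 1 to stay positive. The cutoff acts only on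
  -- a bounded set, because `u + v` tends to infinity.
  have hm : ∀ x, u x / max 1 (u x + v x) ∈ unitInterval := fun x =>
    ⟨div_nonneg (hu0 x) (zero_le_one.trans (le_max_left _ _)),
      (div_le_one (zero_lt_one.trans_le (le_max_left _ _))).2
        ((le_add_of_nonneg_right (hv0 x)).trans (le_max_right _ _))⟩
  have hc : Continuous fun x => u x / max 1 (u x + v x) := by
    have hcu : Continuous u := Metric.continuous_infDist_pt D
    have hcv : Continuous v := Metric.continuous_infDist_pt E
    exact hcu.div (by fun_prop) fun x => (zero_lt_one.trans_le (le_max_left _ _)).ne'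
  let f : C(X, unitInterval) := ⟨fun x => ⟨u x / max 1 (u x + v x), hm x⟩, by fun_prop⟩
  refine ⟨⟨f, isSlowlyOscillating_of_dist_le fun r hr ε hε => ?_⟩,
    {x | u x + v x < 1}, hbd 1, ?_, ?_⟩
  · set M : ℝ := max 1 (3 * r / ε)
    have hM1 : 1 ≤ M := le_max_left _ _
    -- The margin `2 * r` keeps `u + v ≥ M` at every point within `r` of `x`.
    refine ⟨{x | u x + v x < M + 2 * r}, hbd _, fun x hx y hy => ?_⟩
    have hx : M + 2 * r ≤ u x + v x := not_lt.1 hx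
    have h1 := huL x y
    have h2 := hvL x y
    have h3 : |(u x + v x) - (u y + v y)| ≤ 2 * r := by
      have : (u x + v x) - (u y + v y) = (u x - u y) + (v x - v y) := by ring
      rw [this]
      linarith [abs_add_le (u x - u y) (v x - v y)]
    have hyM : M ≤ u y + v y := by linarith [le_abs_self ((u x + v x) - (u y + v y))]
    have hxM : M ≤ u x + v x := by linarith
    change |u x / max 1 (u x + v x) - u y / max 1 (u y + v y)| ≤ ε
    rw [max_eq_right (hM1.trans hxM), max_eq_right (hM1.trans hyM)]
    have hM0 : 0 < M := zero_lt_one.trans_le hM1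
    refine (abs_div_sub_div_le (hu0 y) (le_add_of_nonneg_right (hv0 y)) (h1.trans hy.le) h3 hM0
      hxM hyM).trans ?_
    rw [div_le_iff₀ hM0]
    have := le_max_right 1 (3 * r / ε)
    rw [div_le_iff₀ hε] at this
    linarith
  · rintro x ⟨hx, -⟩
    apply Subtype.ext
    change u x / max 1 (u x + v x) = 0
    rw [hu]
    simp [Metric.infDist_zero_of_mem hx]
  · rintro x ⟨hx, hxK⟩
    apply Subtype.ext
    change u x / max 1 (u x + v x) = 1
    have h0 : v x = 0 := Metric.infDist_zero_of_mem hx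
    have h1 : 1 ≤ u x + v x := not_lt.1 hxK
    rw [max_eq_right h1, h0, add_zero]
    rw [h0, add_zero] at h1
    exact div_self (by linarith)

lemma continuous_higsonMap : Continuous (higsonMap X) :=
  continuous_pi fun φ => φ.1.continuous

/-- A point in the closures of the images of `D` and `E` minus arbitrary bounded sets witnesses
that `D` and `E` are not asymptotically disjoint. -/
lemma AsymptoticallyDisjoint.false_of_mem_closure {D E : Set X} (h : AsymptoticallyDisjoint D E)
    {p : HigsonFunction X → unitInterval}
    (hD : ∀ K : Set X, IsBounded K → p ∈ closure (higsonMap X '' (D \ K)))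
    (hE : ∀ K : Set X, IsBounded K → p ∈ closure (higsonMap X '' (E \ K))) : False := by
  obtain ⟨φ, K, hK, h0, h1⟩ := h.exists_higsonFunction
  have key : ∀ (S : Set X) (t : unitInterval), (∀ x ∈ S, φ.1 x = t) →
      p ∈ closure (higsonMap X '' S) → p φ = t := by
    intro S t hS hp
    have hcl : IsClosed {q : HigsonFunction X → unitInterval | q φ = t} :=
      isClosed_singleton.preimage (continuous_apply φ)
    refine closure_minimal ?_ hcl hp
    rintro _ ⟨x, hx, rfl⟩
    exact hS x hx
  exact zero_ne_one ((key _ 0 h0 (hD K hK)).symm.trans (key _ 1 h1 (hE K hK)))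

/-- Points approximated by points of `X` outside of all bounded sets lie in the Higson corona. -/
lemma mem_higsonCorona {p : HigsonFunction X → unitInterval}
    (h : ∀ K : Set X, IsBounded K → p ∈ closure (higsonMap X '' Kᶜ)) : p ∈ higsonCorona X := by
  refine ⟨closure_mono (Set.image_subset_range _ _) (h ∅ isBounded_empty), ?_⟩
  rintro ⟨x, rfl⟩
  obtain ⟨φ, h1, h0⟩ := exists_higsonFunction_bump x
  have hcl : IsClosed {q : HigsonFunction X → unitInterval | q φ = 0} :=
    isClosed_singleton.preimage (continuous_apply φ)
  have : φ.1 x = 0 := closure_minimal (t := {q : HigsonFunction X → unitInterval | q φ = 0})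
    (by
      rintro _ ⟨y, hy, rfl⟩
      refine h0 y ?_
      rw [dist_comm]
      exact not_lt.1 hy) hcl (h (Metric.ball x 1) Metric.isBounded_ball)
  exact zero_ne_one (this.symm.trans h1)

/-- In a proper space, bounded sets are irrelevant for traces in the Higson corona. -/
lemma mem_closure_diff_of_mem_higsonCorona [ProperSpace X] {p : HigsonFunction X → unitInterval}
    (hp : p ∈ higsonCorona X) {D : Set X} (hD : p ∈ closure (higsonMap X '' D)) {K : Set X}
    (hK : IsBounded K) : p ∈ closure (higsonMap X '' (D \ K)) := by
  have h1 : p ∈ closure (higsonMap X '' (D \ K)) ∪ closure (higsonMap X '' K) := by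
    rw [← closure_union, ← Set.image_union]
    refine closure_mono (Set.image_mono ?_) hD
    intro x hx
    by_cases hxK : x ∈ K
    · exact Or.inr hxK
    · exact Or.inl ⟨hx, hxK⟩
  -- Properness enters here: the closure of `K` is compact, so its image is closed and contains no
  -- corona point.
  refine h1.resolve_right fun h => hp.2 ?_
  have hc : IsCompact (higsonMap X '' closure K) :=
    hK.isCompact_closure.image continuous_higsonMap
  have := closure_minimal (Set.image_mono subset_closure) hc.isClosed h
  exact Set.image_subset_range _ _ this

end

/-! ### Ultralimits in the corona, and separators at a fixed scale -/

section
variable {X : Type*} [MetricSpace X]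
open Bornology Filter Topology

lemma tendsto_cobounded_of_lt_dist {l : Filter ℕ} (hl : l ≤ atTop) {x : ℕ → X} {x₀ : X}
    (h : ∀ᶠ t : ℕ in l, (t : ℝ) < dist (x t) x₀) : Tendsto x l (cobounded X) := by
  rw [← Metric.tendsto_dist_right_atTop_iff x₀]
  refine tendsto_atTop_mono' l (h.mono fun t ht => ht.le) ?_
  exact tendsto_natCast_atTop_atTop.mono_left hl

lemma eventually_notMem_of_tendsto_cobounded {ι : Type*} {l : Filter ι} {x : ι → X}
    (hx : Tendsto x l (cobounded X)) {K : Set X} (hK : IsBounded K) : ∀ᶠ t in l, x t ∉ K :=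
  hx (isBounded_def.1 hK)

lemma mem_closure_diff_of_tendsto {ι : Type*} {l : Filter ι} [l.NeBot] {x : ι → X}
    {p : HigsonFunction X → unitInterval} (hx : Tendsto x l (cobounded X))
    (hp : Tendsto (fun t => higsonMap X (x t)) l (𝓝 p)) {D : Set X} (hD : ∀ᶠ t in l, x t ∈ D)
    {K : Set X} (hK : IsBounded K) : p ∈ closure (higsonMap X '' (D \ K)) := by
  refine mem_closure_of_tendsto hp ?_
  filter_upwards [hD, eventually_notMem_of_tendsto_cobounded hx hK] with t h1 h2
  exact Set.mem_image_of_mem _ ⟨h1, h2⟩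

/-- Each coordinate is slowly oscillating, so bounded perturbations far out do not change the limit.
-/
lemma tendsto_higsonMap_of_dist_le {ι : Type*} {l : Filter ι} {x y : ι → X}
    {p : HigsonFunction X → unitInterval} (hx : Tendsto x l (cobounded X))
    (hp : Tendsto (fun t => higsonMap X (x t)) l (𝓝 p)) {r : ℝ}
    (hxy : ∀ᶠ t in l, dist (x t) (y t) ≤ r) : Tendsto (fun t => higsonMap X (y t)) l (𝓝 p) := by
  rw [tendsto_pi_nhds] at hp ⊢
  intro φ
  refine (hp φ).congr_dist ?_
  rw [Metric.tendsto_nhds]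
  intro ε hε
  obtain ⟨K, hK, h⟩ := φ.2.dist_lt (r := r) hε
  filter_upwards [hxy, eventually_notMem_of_tendsto_cobounded hx hK] with t h1 h2
  rw [Real.dist_0_eq_abs, abs_of_nonneg dist_nonneg]
  exact h _ h2 _ h1

lemma tendsto_cobounded_of_dist_le {ι : Type*} {l : Filter ι} {x y : ι → X}
    (hx : Tendsto x l (cobounded X)) {r : ℝ}
    (hxy : ∀ᶠ t in l, dist (x t) (y t) ≤ r) : Tendsto y l (cobounded X) := by
  intro S hS
  have hK : IsBounded (Metric.thickening (r + 1) Sᶜ) := IsBounded.thickening (isBounded_compl_iff.2 hS)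
  rw [Filter.mem_map]
  filter_upwards [hxy, eventually_notMem_of_tendsto_cobounded hx hK] with t h1 h2
  by_contra hy
  exact h2 (Metric.mem_thickening_iff.2 ⟨y t, hy, by linarith⟩)

lemma exists_tendsto_higsonMap {ι : Type*} (l : Ultrafilter ι) (x : ι → X) :
    ∃ p, Tendsto (fun t => higsonMap X (x t)) l (𝓝 p) := by
  obtain ⟨p, -, hp⟩ := isCompact_univ.ultrafilter_le_nhds
    (l.map fun t => higsonMap X (x t)) (by simp)
  exact ⟨p, hp⟩

/-- Sets that are not asymptotically disjoint have traces that meet in the Higson corona. -/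
lemma exists_mem_closure_of_not_asymptoticallyDisjoint {D E : Set X}
    (h : ¬ AsymptoticallyDisjoint D E) : ∃ p : HigsonFunction X → unitInterval,
      p ∈ higsonCorona X ∧ p ∈ closure (higsonMap X '' D) ∧ p ∈ closure (higsonMap X '' E) := by
  unfold AsymptoticallyDisjoint at h
  push Not at h
  obtain ⟨M, hM⟩ := h
  obtain ⟨x₀, -, -⟩ := hM ∅ isBounded_empty
  choose a ha c hc hac using fun t : ℕ => hM (Metric.closedBall x₀ t) Metric.isBounded_closedBall
  obtain ⟨p, hp⟩ := exists_tendsto_higsonMap (hyperfilter ℕ) a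
  have hx : Tendsto a (hyperfilter ℕ) (cobounded X) :=
    tendsto_cobounded_of_lt_dist (Nat.hyperfilter_le_atTop) (x₀ := x₀)
      (Eventually.of_forall fun t : ℕ => by simpa using (ha t).2)
  have hac' : ∀ᶠ t in (hyperfilter ℕ : Filter ℕ), dist (a t) (c t) ≤ M :=
    Eventually.of_forall fun t => (hac t).le
  refine ⟨p, mem_higsonCorona fun K hK => ?_, ?_, ?_⟩
  · rw [Set.compl_eq_univ_sdiff]
    exact mem_closure_diff_of_tendsto hx hp (Eventually.of_forall fun t => Set.mem_univ _) hK
  · simpa using mem_closure_diff_of_tendsto hx hp (Eventually.of_forall fun t => (ha t).1)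
      isBounded_empty
  · simpa using mem_closure_diff_of_tendsto (tendsto_cobounded_of_dist_le hx hac')
      (tendsto_higsonMap_of_dist_le hx hp hac') (Eventually.of_forall fun t => (hc t).1)
      isBounded_empty

lemma IsAsymptoticSeparator.symm {A B C : Set X} (h : IsAsymptoticSeparator A B C) :
    IsAsymptoticSeparator B A C := by
  obtain ⟨hC, U, V, hU, hV, hUV, hc, hA, hB⟩ := h
  exact ⟨hC, V, U, hV, hU, hUV.symm, by rw [hc, Set.union_comm], hB, hA⟩

lemma IsAsymptoticSeparator.asymptoticallyDisjoint_left {A B C : Set X}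
    (h : IsAsymptoticSeparator A B C) : AsymptoticallyDisjoint A C := by
  by_contra hn
  obtain ⟨p, hp, hA, hC⟩ := exists_mem_closure_of_not_asymptoticallyDisjoint hn
  obtain ⟨-, U, V, hU, hV, hUV, hc, hAU, hB⟩ := h
  have : (⟨p, hp⟩ : higsonCorona X) ∈ (coronaTrace C)ᶜ := by
    rw [hc]
    exact Or.inl (hAU hA)
  exact this hC

/-- Only `a` has to be far out: if `c` lies in the exceptional bounded set, then the distance of `a`
from the base point already forces `a` away from `c`. -/
lemma AsymptoticallyDisjoint.exists_forall_lt_dist {A C : Set X} (h : AsymptoticallyDisjoint A C)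
    (x₀ : X) (t : ℝ) : ∃ m : ℕ, ∀ a ∈ A, (m : ℝ) < dist a x₀ → ∀ c ∈ C, t < dist a c := by
  obtain ⟨K, hK, hd⟩ := h (t + 1)
  obtain ⟨ρ, hρ⟩ := hK.subset_closedBall x₀
  obtain ⟨m, hm⟩ := exists_nat_gt (max ρ 0 + max t 0)
  have h1 := le_max_left ρ 0
  have h2 := le_max_left t 0
  have h3 := le_max_right ρ 0
  have h4 := le_max_right t 0
  refine ⟨m, fun a ha ham c hc => ?_⟩
  by_cases hcK : c ∈ K
  · have := Metric.mem_closedBall.1 (hρ hcK)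
    linarith [dist_triangle a c x₀]
  · have := hd a ⟨ha, fun haK => by linarith [Metric.mem_closedBall.1 (hρ haK)]⟩ c ⟨hc, hcK⟩
    linarith

lemma exists_path_of_reflTransGen {α : Type*} {R : α → α → Prop} {a b : α}
    (h : Relation.ReflTransGen R a b) : ∃ (L : ℕ) (f : ℕ → α), f 0 = a ∧ f L = b ∧
      ∀ i < L, R (f i) (f (i + 1)) := by
  induction h with
  | refl => exact ⟨0, fun _ => a, rfl, rfl, by simp⟩
  | @tail b c _ hbc ih =>
    obtain ⟨L, f, h0, hL, hf⟩ := ih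
    refine ⟨L + 1, fun i => if i ≤ L then f i else c, by simpa using h0, by simp, fun i hi => ?_⟩
    rcases Nat.lt_succ_iff_lt_or_eq.1 hi with hi | rfl
    · simpa [hi.le, Nat.succ_le_of_lt hi] using hf i hi
    · simpa [hL] using hbc

/-- There is no sequence of chains with bounded steps joining `A` to `B` further and further away
from the base point and from a separator. -/
lemma IsAsymptoticSeparator.false_of_paths [ProperSpace X] {A B C : Set X}
    (h : IsAsymptoticSeparator A B C) {r : ℝ} (x₀ : X) {L : ℕ → ℕ} {f : ℕ → ℕ → X}
    (hA : ∀ t, f t 0 ∈ A) (hB : ∀ t, f t (L t) ∈ B)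
    (hfar : ∀ t, ∀ i ≤ L t, (t : ℝ) < dist (f t i) x₀ ∧ ∀ c ∈ C, (t : ℝ) < dist (f t i) c)
    (hstep : ∀ t, ∀ i < L t, dist (f t i) (f t (i + 1)) ≤ r) : False := by
  set l := hyperfilter ℕ
  -- The union of all chains is asymptotically disjoint from `C`, since the first `T` chains
  -- together have only finitely many points.
  set E : Set X := {x | ∃ t, ∃ i ≤ L t, f t i = x} with hEdef
  have hEC : AsymptoticallyDisjoint E C := by
    intro M
    obtain ⟨T, hT⟩ := exists_nat_gt M
    refine ⟨⋃ t ∈ Set.Iio T, (fun i => f t i) '' Set.Iic (L t), ?_, ?_⟩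
    · exact ((Set.finite_Iio T).biUnion fun t _ => (Set.finite_Iic _).image _).isBounded
    · rintro _ ⟨⟨t, i, hi, rfl⟩, hK⟩ c ⟨hc, -⟩
      have htT : T ≤ t := by
        by_contra htT
        refine hK (Set.mem_biUnion (Set.mem_Iio.2 (not_le.1 htT)) ?_)
        exact ⟨i, hi, rfl⟩
      have : (T : ℝ) ≤ t := Nat.cast_le.2 htT
      linarith [(hfar t i hi).2 c hc]
  obtain ⟨-, U₁, U₂, hU₁, hU₂, hdisj, hcompl, hAU, hBU⟩ := h
  obtain ⟨O₁, hO₁, rfl⟩ := isOpen_induced_iff.1 hU₁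
  obtain ⟨O₂, hO₂, rfl⟩ := isOpen_induced_iff.1 hU₂
  set Λ : Set (HigsonFunction X → unitInterval) :=
    ⋂ N : ℕ, closure (higsonMap X '' (E \ Metric.closedBall x₀ N)) with hΛ
  have hΛc : IsClosed Λ := isClosed_iInter fun _ => isClosed_closure
  have hΛmem : ∀ p ∈ Λ, ∀ K : Set X, IsBounded K → p ∈ closure (higsonMap X '' (E \ K)) := by
    intro p hp K hK
    obtain ⟨ρ, hρ⟩ := hK.subset_closedBall x₀
    obtain ⟨N, hN⟩ := exists_nat_gt ρ
    exact closure_mono (Set.image_mono (Set.sdiff_subset_sdiff_right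
      (hρ.trans (Metric.closedBall_subset_closedBall hN.le)))) (Set.mem_iInter.1 hp N)
  have hΛν : ∀ p ∈ Λ, p ∈ higsonCorona X := fun p hp => mem_higsonCorona fun K hK =>
    closure_mono (Set.image_mono fun x hx => hx.2) (hΛmem p hp K hK)
  have hΛO : ∀ p ∈ Λ, p ∈ O₁ ∨ p ∈ O₂ := by
    intro p hp
    have : (⟨p, hΛν p hp⟩ : higsonCorona X) ∈ (coronaTrace C)ᶜ := fun hC =>
      hEC.false_of_mem_closure (hΛmem p hp)
        fun K hK => mem_closure_diff_of_mem_higsonCorona (hΛν p hp) hC hK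
    rw [hcompl] at this
    exact this.elim Or.inl Or.inr
  have hΛO' : ∀ p ∈ Λ, p ∈ O₁ → p ∉ O₂ := fun p hp h1 h2 =>
    Set.disjoint_left.1 hdisj (show (⟨p, hΛν p hp⟩ : higsonCorona X) ∈ _ from h1) h2
  -- `O₁` and `O₂` need to be disjoint only on the corona. The two compact parts of the limit set
  -- `Λ` have neighbourhoods that are disjoint in the whole cube, where the chain points live.
  obtain ⟨W₁, W₂, hW₁, hW₂, hK₁, hK₂, hW⟩ : SeparatedNhds (Λ \ O₂) (Λ \ O₁) := by
    refine SeparatedNhds.of_isCompact_isCompact (hΛc.sdiff hO₂).isCompact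
      (hΛc.sdiff hO₁).isCompact (Set.disjoint_left.2 ?_)
    rintro p ⟨hp, h2⟩ ⟨-, h1⟩
    exact (hΛO p hp).elim h1 h2
  have hlim : ∀ i : ℕ → ℕ, (∀ᶠ t in (l : Filter ℕ), i t ≤ L t) →
      Tendsto (fun t => f t (i t)) l (cobounded X) ∧
      ∃ p ∈ Λ, Tendsto (fun t => higsonMap X (f t (i t))) l (𝓝 p) := by
    intro i hi
    have hx : Tendsto (fun t => f t (i t)) l (cobounded X) :=
      tendsto_cobounded_of_lt_dist Nat.hyperfilter_le_atTop (x₀ := x₀)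
        (hi.mono fun t ht => (hfar t _ ht).1)
    obtain ⟨p, hp⟩ := exists_tendsto_higsonMap l (fun t => f t (i t))
    refine ⟨hx, p, Set.mem_iInter.2 fun N => ?_, hp⟩
    exact mem_closure_diff_of_tendsto (D := E) hx hp (hi.mono fun t ht => ⟨t, i t, ht, rfl⟩)
      Metric.isBounded_closedBall
  have hΛW : ∀ p ∈ Λ, p ∈ W₁ ∪ W₂ := by
    intro p hp
    rcases hΛO p hp with h1 | h2
    · exact Or.inl (hK₁ ⟨hp, hΛO' p hp h1⟩)
    · exact Or.inr (hK₂ ⟨hp, fun h1 => hΛO' p hp h1 h2⟩)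
  have hstart : ∀ᶠ t in (l : Filter ℕ), higsonMap X (f t 0) ∈ W₁ := by
    obtain ⟨hx, p, hp, hlimp⟩ := hlim (fun _ => 0) (Eventually.of_forall fun t => Nat.zero_le _)
    refine hlimp.eventually_mem (hW₁.mem_nhds (hK₁ ⟨hp, hΛO' p hp ?_⟩))
    suffices h : (⟨p, hΛν p hp⟩ : higsonCorona X) ∈ coronaTrace A from hAU h
    change p ∈ closure _
    simpa using mem_closure_diff_of_tendsto hx hlimp (Eventually.of_forall hA) isBounded_empty
  have hend : ∀ᶠ t in (l : Filter ℕ), higsonMap X (f t (L t)) ∈ W₂ := by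
    obtain ⟨hx, p, hp, hlimp⟩ := hlim L (Eventually.of_forall fun t => le_rfl)
    refine hlimp.eventually_mem (hW₂.mem_nhds (hK₂ ⟨hp, fun h1 => hΛO' p hp h1 ?_⟩))
    suffices h : (⟨p, hΛν p hp⟩ : higsonCorona X) ∈ coronaTrace B from hBU h
    change p ∈ closure _
    simpa using mem_closure_diff_of_tendsto hx hlimp (Eventually.of_forall hB) isBounded_empty
  have hin : ∀ᶠ t in (l : Filter ℕ), ∀ i ≤ L t, higsonMap X (f t i) ∈ W₁ ∪ W₂ := by
    by_contra hcon
    rw [← Ultrafilter.eventually_not] at hcon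
    push Not at hcon
    obtain ⟨i, hi⟩ := hcon.choice
    obtain ⟨-, p, hp, hlimp⟩ := hlim i (hi.mono fun t ht => ht.1)
    obtain ⟨t, h1, h2⟩ := (hi.and (hlimp.eventually_mem
      ((hW₁.union hW₂).mem_nhds (hΛW p hp)))).exists
    exact h1.2 h2
  -- Consecutive chain points have the same ultralimit, so almost no chain can step out of `W₁`.
  have hnext : ∀ᶠ t in (l : Filter ℕ), ∀ i < L t, higsonMap X (f t i) ∈ W₁ →
      higsonMap X (f t (i + 1)) ∈ W₁ := by
    by_contra hcon
    rw [← Ultrafilter.eventually_not] at hcon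
    push Not at hcon
    obtain ⟨i, hi⟩ := hcon.choice
    obtain ⟨hx, p, hp, hlimp⟩ := hlim i (hi.mono fun t ht => ht.1.le)
    have hlimp' := tendsto_higsonMap_of_dist_le hx hlimp (y := fun t => f t (i t + 1))
      (hi.mono fun t ht => hstep t _ ht.1)
    rcases hΛW p hp with h1 | h2
    · obtain ⟨t, h3, h4⟩ := (hi.and (hlimp'.eventually_mem (hW₁.mem_nhds h1))).exists
      exact h3.2.2 h4
    · obtain ⟨t, h3, h4⟩ := (hi.and (hlimp.eventually_mem (hW₂.mem_nhds h2))).exists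
      exact Set.disjoint_left.1 hW h3.2.1 h4
  obtain ⟨t, h0, h1, h2⟩ := (hstart.and (hend.and hnext)).exists
  have : ∀ i ≤ L t, higsonMap X (f t i) ∈ W₁ := by
    intro i
    induction i with
    | zero => exact fun _ => h0
    | succ i ih => exact fun hi => h2 i hi (ih (Nat.le_of_succ_le hi))
  exact Set.disjoint_left.1 hW (this _ le_rfl) h1

/-- Outside of a large ball and of a neighbourhood of a separator of `A` and `B`, the space splits
into two parts that are `r`-far from each other. -/
lemma IsAsymptoticSeparator.exists_farApart [ProperSpace X] {A B C : Set X}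
    (h : IsAsymptoticSeparator A B C) (x₀ : X) (r : ℕ) : ∃ t m : ℕ, ∃ U V : Set X,
      A \ Metric.closedBall x₀ m ⊆ U ∧ B \ Metric.closedBall x₀ m ⊆ V ∧ FarApart r U V ∧
      ∀ x ∉ Metric.closedBall x₀ (m : ℝ), x ∈ U ∨ x ∈ V ∨ ∃ c ∈ C, dist x c ≤ t := by
  choose mA hmA using fun t : ℕ =>
    h.asymptoticallyDisjoint_left.exists_forall_lt_dist x₀ (t : ℝ)
  choose mB hmB using fun t : ℕ =>
    h.symm.asymptoticallyDisjoint_left.exists_forall_lt_dist x₀ (t : ℝ)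
  -- The first two summands put the far parts of `A` and `B` into `G t`; the last one drives the
  -- chains away from the base point.
  set m : ℕ → ℕ := fun t => mA t + mB t + t with hm
  have hlt : ∀ t, ∀ x ∉ Metric.closedBall x₀ (m t : ℝ), (mA t : ℝ) < dist x x₀ ∧
      (mB t : ℝ) < dist x x₀ ∧ (t : ℝ) < dist x x₀ := by
    intro t x hx
    rw [Metric.mem_closedBall, not_le] at hx
    simp only [hm, Nat.cast_add] at hx
    have h1 : (0 : ℝ) ≤ mA t := Nat.cast_nonneg _
    have h2 : (0 : ℝ) ≤ mB t := Nat.cast_nonneg _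
    have h3 : (0 : ℝ) ≤ t := Nat.cast_nonneg _
    exact ⟨by linarith, by linarith, by linarith⟩
  set G : ℕ → Set X := fun t => {x | x ∉ Metric.closedBall x₀ (m t : ℝ) ∧
    ∀ c ∈ C, (t : ℝ) < dist x c} with hG
  have hAG : ∀ t, A \ Metric.closedBall x₀ (m t) ⊆ G t := fun t a ha =>
    ⟨ha.2, hmA t a ha.1 (hlt t a ha.2).1⟩
  have hBG : ∀ t, B \ Metric.closedBall x₀ (m t) ⊆ G t := fun t a ha =>
    ⟨ha.2, hmB t a ha.1 (hlt t a ha.2).2.1⟩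
  by_contra hcon
  push Not at hcon
  have hpath : ∀ t : ℕ, ∃ (L : ℕ) (f : ℕ → X), f 0 ∈ A ∧ f L ∈ B ∧ (∀ i ≤ L, f i ∈ G t) ∧
      ∀ i < L, dist (f i) (f (i + 1)) ≤ r := by
    intro t
    -- The points reachable from `A` by `r`-steps inside `G t` are `r`-far from the rest of `G t`.
    -- If no far point of `B` were reachable, this splitting would satisfy the claim; hence there is
    -- a chain from `A` to `B`.
    set U : Set X := {y | ∃ a ∈ A \ Metric.closedBall x₀ (m t),
      Relation.ReflTransGen (fun x y => dist x y ≤ r ∧ y ∈ G t) a y} with hU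
    by_cases hBU : ∃ b ∈ B \ Metric.closedBall x₀ (m t), b ∈ U
    · obtain ⟨b, hb, a, ha, hab⟩ := hBU
      obtain ⟨L, f, h0, hL, hf⟩ := exists_path_of_reflTransGen hab
      refine ⟨L, f, h0 ▸ ha.1, hL ▸ hb.1, fun i hi => ?_, fun i hi => (hf i hi).1⟩
      rcases i with _ | i
      · exact h0 ▸ hAG t ha
      · exact (hf i hi).2
    · exfalso
      push Not at hBU
      obtain ⟨x, hx, hxU, hxV, hxC⟩ := hcon t (m t) U (G t \ U)
        (fun a ha => ⟨a, ha, Relation.ReflTransGen.refl⟩) (fun b hb => ⟨hBG t hb, hBU b hb⟩) (by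
          rintro u ⟨a, ha, hau⟩ v ⟨hv, hvU⟩
          by_contra hle
          exact hvU ⟨a, ha, hau.tail ⟨not_lt.1 hle, hv⟩⟩)
      exact hxV ⟨⟨hx, hxC⟩, hxU⟩
  choose L f hA hB hf hstep using hpath
  exact h.false_of_paths x₀ hA hB
    (fun t i hi => ⟨(hlt t _ (hf t i hi).1).2.2, (hf t i hi).2⟩) hstep

end

/-! ### A crossing criterion for asymptotic separators -/

section
variable {X : Type*} [MetricSpace X]
open Bornology Filter Topology

/-- If `U` and `V` cover `X` and pairs of points of `U` and `V` at a bounded distance from each other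
stay at a bounded distance from `F`, then the traces of `U` and `V` meet in the trace of `F` only. -/
lemma mem_closure_of_crossing [ProperSpace X] {F U V : Set X}
    (hcross : ∀ r : ℝ, ∃ K : Set X, IsBounded K ∧ ∃ h : ℝ, ∀ u ∈ U \ K, ∀ v ∈ V \ K,
      dist u v ≤ r → ∃ f ∈ F, dist u f ≤ h)
    {p : HigsonFunction X → unitInterval} (hp : p ∈ higsonCorona X)
    (hpU : p ∈ closure (higsonMap X '' U)) (hpV : p ∈ closure (higsonMap X '' V)) :
    p ∈ closure (higsonMap X '' F) := by
  by_contra hpF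
  obtain ⟨_, ⟨x₀, -, -⟩⟩ := closure_nonempty_iff.1 ⟨p, hpU⟩
  obtain ⟨I, u, hu, hsub⟩ := isOpen_pi_iff.1 isClosed_closure.isOpen_compl p hpF
  choose! ε hε hball using fun i (hi : i ∈ I) => Metric.isOpen_iff.1 (hu i hi).1 _ (hu i hi).2
  -- Half radii leave room for oscillation: far out, every point within `M` of the preimage `E` of
  -- `N` still maps into the neighbourhood that misses `F`. So `E` is asymptotically disjoint from
  -- `F`, and crossings between `U` and `V` cannot occur far out in `E`.
  set N : Set (HigsonFunction X → unitInterval) := {q | ∀ i ∈ I, dist (q i) (p i) < ε i / 2}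
    with hN
  have hNo : IsOpen N := by
    have : N = ⋂ i ∈ I, {q | dist (q i) (p i) < ε i / 2} := by
      ext q
      simp [hN]
    rw [this]
    exact isOpen_biInter_finset fun i _ =>
      isOpen_lt ((continuous_apply i).dist continuous_const) continuous_const
  have hpN : p ∈ N := fun i hi => by
    rw [dist_self]
    exact half_pos (hε i hi)
  set E : Set X := higsonMap X ⁻¹' N
  have hcl : ∀ D : Set X, p ∈ closure (higsonMap X '' D) →
      p ∈ closure (higsonMap X '' (D ∩ E)) := by
    intro D hD
    rw [Set.image_inter_preimage, Set.inter_comm]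
    exact hNo.inter_closure ⟨hpN, hD⟩
  have hEF : AsymptoticallyDisjoint E F := by
    intro M
    choose! K hK hosc using fun (i : HigsonFunction X) (hi : i ∈ I) =>
      i.2.dist_lt (r := M) (half_pos (hε i hi))
    refine ⟨⋃ i ∈ I, K i, (isBounded_biUnion_finset I).2 hK, ?_⟩
    rintro e ⟨he, heK⟩ f ⟨hf, -⟩
    by_contra! hlt
    have hmem : higsonMap X f ∈ (I : Set (HigsonFunction X)).pi u := by
      intro i hi
      refine hball i hi ?_
      have h1 := hosc i hi e (fun h => heK (Set.mem_biUnion hi h)) f hlt.le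
      have h2 : dist (i.1 e) (p i) < ε i / 2 := he i hi
      rw [Metric.mem_ball]
      change dist (i.1 f) (p i) < ε i
      linarith [dist_triangle_left (i.1 f) (p i) (i.1 e)]
    exact hsub hmem (subset_closure (Set.mem_image_of_mem _ hf))
  have hUV : AsymptoticallyDisjoint (U ∩ E) (V ∩ E) := by
    intro M
    obtain ⟨K, hK, h, hUV⟩ := hcross M
    obtain ⟨m, hm⟩ := hEF.exists_forall_lt_dist x₀ h
    refine ⟨K ∪ Metric.closedBall x₀ m, hK.union Metric.isBounded_closedBall, ?_⟩
    rintro a ⟨⟨haU, haE⟩, haK⟩ b ⟨⟨hbV, -⟩, hbK⟩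
    by_contra! hlt
    obtain ⟨f, hf, haf⟩ := hUV a ⟨haU, fun h => haK (Or.inl h)⟩ b
      ⟨hbV, fun h => hbK (Or.inl h)⟩ hlt.le
    have : (m : ℝ) < dist a x₀ := not_le.1 fun h => haK (Or.inr h)
    exact absurd haf (not_le.2 (hm a haE this f hf))
  exact hUV.false_of_mem_closure
    (fun K hK => mem_closure_diff_of_mem_higsonCorona hp (hcl U hpU) hK)
    (fun K hK => mem_closure_diff_of_mem_higsonCorona hp (hcl V hpV) hK)

/-- The closed traces of `U` and `V` cover the corona and meet only inside the trace of `F`. The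
complements of these traces, with the trace of `F` removed, therefore form the partition. -/
lemma isAsymptoticSeparator_of_crossing [ProperSpace X] {A B F U V : Set X} (hF : IsClosed F)
    (hUV : U ∪ V = Set.univ)
    (hcross : ∀ r : ℝ, ∃ K : Set X, IsBounded K ∧ ∃ h : ℝ, ∀ u ∈ U \ K, ∀ v ∈ V \ K,
      dist u v ≤ r → ∃ f ∈ F, dist u f ≤ h)
    (hAF : AsymptoticallyDisjoint A F) (hBF : AsymptoticallyDisjoint B F)
    (hA : ∃ K : Set X, IsBounded K ∧ A \ K ⊆ U) (hB : ∃ K : Set X, IsBounded K ∧ B \ K ⊆ V) :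
    IsAsymptoticSeparator A B F := by
  have htr : ∀ D : Set X, IsClosed (coronaTrace D) := fun D =>
    isClosed_closure.preimage continuous_subtype_val
  have hcov : ∀ p : higsonCorona X, p ∈ coronaTrace U ∪ coronaTrace V := by
    rintro ⟨p, hp⟩
    have h1 : p ∈ closure (higsonMap X '' (U ∪ V)) := by
      rw [hUV, Set.image_univ]
      exact hp.1
    rw [Set.image_union, closure_union] at h1
    exact h1
  have hinter : ∀ p : higsonCorona X, p ∈ coronaTrace U → p ∈ coronaTrace V →
      p ∈ coronaTrace F := fun p hU hV => mem_closure_of_crossing hcross p.2 hU hV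
  have hdis : ∀ {D : Set X}, AsymptoticallyDisjoint D F → ∀ p : higsonCorona X,
      p ∈ coronaTrace D → p ∉ coronaTrace F := fun hD p h1 h2 => hD.false_of_mem_closure
    (fun K hK => mem_closure_diff_of_mem_higsonCorona p.2 h1 hK)
    (fun K hK => mem_closure_diff_of_mem_higsonCorona p.2 h2 hK)
  have hsub : ∀ {D W : Set X}, (∃ K : Set X, IsBounded K ∧ D \ K ⊆ W) →
      coronaTrace D ⊆ coronaTrace W := by
    rintro D W ⟨K, hK, h⟩ p hp
    exact closure_mono (Set.image_mono h) (mem_closure_diff_of_mem_higsonCorona p.2 hp hK)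
  refine ⟨hF, (coronaTrace V ∪ coronaTrace F)ᶜ, (coronaTrace U ∪ coronaTrace F)ᶜ,
    ((htr V).union (htr F)).isOpen_compl, ((htr U).union (htr F)).isOpen_compl, ?_, ?_, ?_, ?_⟩
  · rw [Set.disjoint_left]
    intro p h1 h2
    exact (hcov p).elim (fun h => h2 (Or.inl h)) fun h => h1 (Or.inl h)
  · ext p
    have h1 := hcov p
    have h2 := hinter p
    simp only [Set.mem_compl_iff, Set.mem_union] at h1 ⊢
    tauto
  · intro p hp hVF
    have h1 := hdis hAF p hp
    exact hVF.elim (fun h => h1 (hinter p (hsub hA hp) h)) h1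
  · intro p hp hUF
    have h1 := hdis hBF p hp
    exact hUF.elim (fun h => h1 (hinter p h (hsub hB hp))) h1

end

/-! ### Uniform control from a generic pair of sets -/

section
variable {X : Type*} [MetricSpace X]
open Bornology Filter Topology

/-- The pair `A`, `B` has a separator of scale dimension less than `n` that works at all scales up
to `R` outside of the ball of radius `γ R` about `x₀`, with control `γ`. -/
def HasScaleSeparator (x₀ : X) (n : ℕ) (γ : ℕ → ℕ) (R : ℕ) (A B : Set X) : Prop :=
  ∃ C : Set X, (∀ K ⊆ C, IsBounded K → ScaleDimLT n γ R K) ∧ ∀ r ≤ R, ∃ U V : Set X,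
    A \ Metric.closedBall x₀ (γ R) ⊆ U ∧ B \ Metric.closedBall x₀ (γ R) ⊆ V ∧ FarApart r U V ∧
    ∀ x ∉ Metric.closedBall x₀ (γ R : ℝ), x ∈ U ∨ x ∈ V ∨ ∃ c ∈ C, dist x c ≤ γ r

lemma IsAsymptoticSeparator.exists_hasScaleSeparator [ProperSpace X] {A B C : Set X}
    (h : IsAsymptoticSeparator A B C) (x₀ : X) {n : ℕ} {γ : ℕ → ℕ}
    (hC : ∀ R : ℕ, ∃ D : Set X, IsBounded D ∧ ∀ K ⊆ C, IsBounded K → Disjoint K D →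
      ScaleDimLT n γ R K) : ∃ γ' : ℕ → ℕ, ∀ R, HasScaleSeparator x₀ n γ' R A B := by
  choose t m U V hU hV hUV hcov using h.exists_farApart x₀
  choose D hD hdim using hC
  have hρ : ∀ R, ∃ ρ : ℕ, D R ⊆ Metric.closedBall x₀ ρ := fun R => by
    obtain ⟨ρ, hρ⟩ := (hD R).subset_closedBall x₀
    obtain ⟨N, hN⟩ := exists_nat_gt ρ
    exact ⟨N, hρ.trans (Metric.closedBall_subset_closedBall hN.le)⟩
  choose ρ hρ using hρ
  -- Summing over `r ≤ R` lets one ball, of radius `γ' R`, serve all scales up to `R`.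
  set γ' : ℕ → ℕ := fun R => ∑ r ∈ Finset.range (R + 1), (γ r + t r + m r) + ρ R with hγ'
  have hle : ∀ R, ∀ r ≤ R, γ r + t r + m r + ρ R ≤ γ' R := fun R r hr => by
    have := Finset.single_le_sum (f := fun r => γ r + t r + m r) (s := Finset.range (R + 1))
      (fun i _ => Nat.zero_le _) (Finset.mem_range.2 (Nat.lt_succ_of_le hr))
    simp only [hγ']
    omega
  refine ⟨γ', fun R => ⟨C \ Metric.closedBall x₀ (ρ R), fun K hK hKb => ?_, fun r hr => ?_⟩⟩
  · refine (hdim R K (hK.trans Set.sdiff_subset) hKb ?_).mono le_rfl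
      (fun r _ => by have := hle r r le_rfl; omega) le_rfl
    exact Set.disjoint_left.2 fun x hx hxD => (hK hx).2 (hρ R hxD)
  · have hball : Metric.closedBall x₀ (m r : ℝ) ⊆ Metric.closedBall x₀ (γ' R : ℝ) :=
      Metric.closedBall_subset_closedBall (Nat.cast_le.2 (by have := hle R r hr; omega))
    refine ⟨U r, V r, (Set.sdiff_subset_sdiff_right hball).trans (hU r),
      (Set.sdiff_subset_sdiff_right hball).trans (hV r), hUV r, fun x hx => ?_⟩
    rcases hcov r x (fun h => hx (hball h)) with h | h | ⟨c, hc, hd⟩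
    · exact Or.inl h
    · exact Or.inr (Or.inl h)
    -- Discarding the part of `C` in the ball of radius `ρ R` does no harm: points within `t r` of
    -- it lie in the ball of radius `γ' R`.
    · refine Or.inr (Or.inr ⟨c, ⟨hc, fun hcρ => hx ?_⟩, hd.trans (Nat.cast_le.2 ?_)⟩)
      · rw [Metric.mem_closedBall] at hcρ ⊢
        have h1 : ((t r + ρ R : ℕ) : ℝ) ≤ γ' R := Nat.cast_le.2 (by have := hle R r hr; omega)
        push_cast at h1
        linarith [dist_triangle x c x₀]
      · have := hle r r le_rfl
        omega

/-- A description of a pair of subsets of `X` inside of a ball, together with a lower bound for the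
distances that involve points outside of this ball. -/
structure PairPattern (x₀ : X) where
  /-- the radius of the ball -/
  radius : ℕ
  /-- the part of the first set inside of the ball -/
  fst : Set X
  /-- the part of the second set inside of the ball -/
  snd : Set X
  /-- the lower bound for distances outside of the ball -/
  gap : ℕ
  fst_subset : fst ⊆ Metric.closedBall x₀ radius
  snd_subset : snd ⊆ Metric.closedBall x₀ radius

namespace PairPattern
variable {x₀ : X}

/-- The pair `A`, `B` matches the pattern `p`. -/
structure Matches (p : PairPattern x₀) (A B : Set X) : Prop where
  fst_eq : A ∩ Metric.closedBall x₀ p.radius = p.fst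
  snd_eq : B ∩ Metric.closedBall x₀ p.radius = p.snd
  gap_lt : ∀ a ∈ A, ∀ b ∈ B, (a ∉ Metric.closedBall x₀ (p.radius : ℝ) ∨
    b ∉ Metric.closedBall x₀ (p.radius : ℝ)) → (p.gap : ℝ) < dist a b

/-- The pattern `q` is more precise than the pattern `p`. -/
structure Refines (q p : PairPattern x₀) : Prop where
  radius_le : p.radius ≤ q.radius
  gap_le : p.gap ≤ q.gap
  matches' : p.Matches q.fst q.snd

lemma Refines.matches_of_matches {q p : PairPattern x₀} (h : q.Refines p) {A B : Set X}
    (hq : q.Matches A B) : p.Matches A B := by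
  have hball : Metric.closedBall x₀ (p.radius : ℝ) ⊆ Metric.closedBall x₀ (q.radius : ℝ) :=
    Metric.closedBall_subset_closedBall (Nat.cast_le.2 h.radius_le)
  refine ⟨?_, ?_, fun a ha b hb hab => ?_⟩
  · rw [← h.matches'.fst_eq, ← hq.fst_eq, Set.inter_assoc, Set.inter_eq_self_of_subset_right hball]
  · rw [← h.matches'.snd_eq, ← hq.snd_eq, Set.inter_assoc, Set.inter_eq_self_of_subset_right hball]
  · by_cases h1 : a ∈ Metric.closedBall x₀ (q.radius : ℝ) ∧
        b ∈ Metric.closedBall x₀ (q.radius : ℝ)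
    · exact h.matches'.gap_lt a (hq.fst_eq ▸ ⟨ha, h1.1⟩) b (hq.snd_eq ▸ ⟨hb, h1.2⟩) hab
    · exact lt_of_le_of_lt (Nat.cast_le.2 h.gap_le) (hq.gap_lt a ha b hb (not_and_or.1 h1))

lemma Refines.trans {q' q p : PairPattern x₀} (h' : q'.Refines q) (h : q.Refines p) :
    q'.Refines p :=
  ⟨h.radius_le.trans h'.radius_le, h.gap_le.trans h'.gap_le, h.matches_of_matches h'.matches'⟩

lemma matches_of_radius_le {p : PairPattern x₀} : p.Matches p.fst p.snd :=
  ⟨Set.inter_eq_self_of_subset_left p.fst_subset, Set.inter_eq_self_of_subset_left p.snd_subset,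
    fun _ ha _ hb h => (h.elim (fun h => h (p.fst_subset ha)) fun h => h (p.snd_subset hb)).elim⟩

lemma Refines.refl (p : PairPattern x₀) : p.Refines p := ⟨le_rfl, le_rfl, matches_of_radius_le⟩

/-- Enlarge the ball and the gap of a pattern without adding points. -/
def bump (p : PairPattern x₀) : PairPattern x₀ where
  radius := p.radius + 1
  fst := p.fst
  snd := p.snd
  gap := p.gap + 1
  fst_subset := p.fst_subset.trans (Metric.closedBall_subset_closedBall (by simp))
  snd_subset := p.snd_subset.trans (Metric.closedBall_subset_closedBall (by simp))

lemma bump_refines (p : PairPattern x₀) : p.bump.Refines p :=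
  ⟨Nat.le_succ _, Nat.le_succ _, matches_of_radius_le⟩

/-- A sequence of finer and finer patterns with gaps tending to infinity is matched by a pair of
asymptotically disjoint sets. -/
lemma exists_matches_of_refines {p : ℕ → PairPattern x₀} (hp : ∀ j, (p (j + 1)).Refines (p j))
    (hgap : ∀ j, j ≤ (p j).gap) : ∃ A B : Set X, AsymptoticallyDisjoint A B ∧
      ∀ j, (p j).Matches A B := by
  have hle : ∀ i j, i ≤ j → (p j).Refines (p i) := fun i j hij => by
    induction j, hij using Nat.le_induction with
    | base => exact Refines.refl _
    | succ j _ ih => exact (hp j).trans ih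
  have hfst : ∀ i j, i ≤ j → (p i).fst ⊆ (p j).fst := fun i j hij => by
    rw [← (hle i j hij).matches'.fst_eq]
    exact Set.inter_subset_left
  have hsnd : ∀ i j, i ≤ j → (p i).snd ⊆ (p j).snd := fun i j hij => by
    rw [← (hle i j hij).matches'.snd_eq]
    exact Set.inter_subset_left
  have hmatch : ∀ j, (p j).Matches (⋃ i, (p i).fst) (⋃ i, (p i).snd) := by
    refine fun j => ⟨Set.Subset.antisymm ?_ ?_, Set.Subset.antisymm ?_ ?_, ?_⟩
    · rintro x ⟨hx, hxb⟩
      obtain ⟨i, hi⟩ := Set.mem_iUnion.1 hx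
      rw [← (hle j (max i j) (le_max_right _ _)).matches'.fst_eq]
      exact ⟨hfst _ _ (le_max_left _ _) hi, hxb⟩
    · exact fun x hx => ⟨Set.mem_iUnion.2 ⟨j, hx⟩, (p j).fst_subset hx⟩
    · rintro x ⟨hx, hxb⟩
      obtain ⟨i, hi⟩ := Set.mem_iUnion.1 hx
      rw [← (hle j (max i j) (le_max_right _ _)).matches'.snd_eq]
      exact ⟨hsnd _ _ (le_max_left _ _) hi, hxb⟩
    · exact fun x hx => ⟨Set.mem_iUnion.2 ⟨j, hx⟩, (p j).snd_subset hx⟩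
    · intro a ha b hb hab
      obtain ⟨i, hi⟩ := Set.mem_iUnion.1 ha
      obtain ⟨i', hi'⟩ := Set.mem_iUnion.1 hb
      exact (hle j (max j (max i i')) (le_max_left _ _)).matches'.gap_lt a
        (hfst _ _ ((le_max_left _ _).trans (le_max_right _ _)) hi) b
        (hsnd _ _ ((le_max_right _ _).trans (le_max_right _ _)) hi') hab
  refine ⟨_, _, fun M => ?_, hmatch⟩
  obtain ⟨j, hj⟩ := exists_nat_gt M
  refine ⟨Metric.closedBall x₀ (p j).radius, Metric.isBounded_closedBall, fun a ha b hb => ?_⟩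
  have h1 := (hmatch j).gap_lt a ha.1 b hb.1 (Or.inl ha.2)
  have h2 : (j : ℝ) ≤ (p j).gap := Nat.cast_le.2 (hgap j)
  linarith

/-- Given countably many properties of pairs, there is a pair of asymptotically disjoint sets such
that each property of this pair holds densely below some pattern. -/
lemma exists_dense (x₀ : X) {T : Type*} [Countable T] [Nonempty T] (S : T → Set X → Set X → Prop) :
    ∃ A B : Set X, AsymptoticallyDisjoint A B ∧ ∀ τ, S τ A B → ∃ p : PairPattern x₀,
      ∀ q : PairPattern x₀, q.Refines p → ∃ A' B' : Set X, q.Matches A' B' ∧ S τ A' B' := by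
  obtain ⟨τ, hτ⟩ := exists_surjective_nat T
  let Avoids : PairPattern x₀ → T → Prop := fun q τ => ∀ A B, q.Matches A B → ¬ S τ A B
  -- As in Baire's theorem, each property is decided in turn: it is excluded by some refinement, or
  -- no refinement excludes it. Bumping makes the gaps tend to infinity, so that the limit pair is
  -- asymptotically disjoint.
  have hstep : ∀ (p : PairPattern x₀) (τ : T), ∃ q : PairPattern x₀, q.Refines p ∧
      p.gap + 1 ≤ q.gap ∧ (Avoids q τ ∨ ∀ q' : PairPattern x₀, q'.Refines p → ¬ Avoids q' τ) := by
    intro p τ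
    by_cases h : ∃ q : PairPattern x₀, q.Refines p ∧ Avoids q τ
    · obtain ⟨q, hq, hav⟩ := h
      exact ⟨q.bump, q.bump_refines.trans hq, Nat.succ_le_succ hq.gap_le,
        Or.inl fun A B hm => hav A B (q.bump_refines.matches_of_matches hm)⟩
    · push Not at h
      exact ⟨p.bump, p.bump_refines, le_rfl, Or.inr h⟩
  choose next hnext hgap hav using hstep
  let p : ℕ → PairPattern x₀ := fun j =>
    Nat.rec ⟨0, ∅, ∅, 0, Set.empty_subset _, Set.empty_subset _⟩ (fun j p => next p (τ j)) j
  have hgapj : ∀ j, j ≤ (p j).gap := fun j => by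
    induction j with
    | zero => exact Nat.zero_le _
    | succ j ih => exact (Nat.succ_le_succ ih).trans (hgap (p j) (τ j))
  obtain ⟨A, B, hAB, hm⟩ := exists_matches_of_refines (p := p) (fun j => hnext (p j) (τ j)) hgapj
  refine ⟨A, B, hAB, fun σ hσ => ?_⟩
  obtain ⟨j, rfl⟩ := hτ σ
  have h := (hav (p j) (τ j)).resolve_left fun h => h A B (hm (j + 1)) hσ
  refine ⟨p j, fun q hq => ?_⟩
  have := h q hq
  simp only [Avoids] at this
  push Not at this
  exact this

end PairPattern

/-- If every two asymptotically disjoint sets have a separator that is controlled at all scales,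
then there is a common control for all pairs, and the scale dimension of `X` is finite far out. -/
lemma exists_scaleDimLT_of_hasScaleSeparator (x₀ : X)
    (h : ∀ A B : Set X, AsymptoticallyDisjoint A B →
      ∃ n γ, ∀ R, HasScaleSeparator x₀ n γ R A B) :
    ∃ n γ, ∀ R : ℕ, ∃ D : Set X, IsBounded D ∧ ∀ K, IsBounded K → Disjoint K D →
      ScaleDimLT n γ R K := by
  -- Control functions are uncountable in number, but a dimension together with a finite initial
  -- segment ranges over a countable set.
  obtain ⟨A₀, B₀, hAB₀, hdense⟩ := PairPattern.exists_dense x₀ (T := ℕ × List ℕ)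
    fun τ A B => ∃ γ : ℕ → ℕ, (List.range τ.2.length).map γ = τ.2 ∧
      ∀ R, HasScaleSeparator x₀ τ.1 γ R A B
  obtain ⟨n, γ, hγ⟩ := h A₀ B₀ hAB₀
  have hdense' : ∀ R : ℕ, ∃ p : PairPattern x₀, ∀ q : PairPattern x₀, q.Refines p →
      ∃ A B : Set X, q.Matches A B ∧ ∃ γ' : ℕ → ℕ, (∀ r ≤ R, γ' r = γ r) ∧
        HasScaleSeparator x₀ n γ' R A B := by
    intro R
    obtain ⟨p, hp⟩ := hdense (n, (List.range (R + 1)).map γ) ⟨γ, by simp, hγ⟩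
    refine ⟨p, fun q hq => ?_⟩
    obtain ⟨A, B, hm, γ', hγ', hs⟩ := hp q hq
    refine ⟨A, B, hm, γ', fun r hr => ?_, hs R⟩
    simp only [List.length_map, List.length_range] at hγ'
    exact List.map_inj_left.1 hγ' r (List.mem_range.2 (Nat.lt_succ_of_le hr))
  choose p hp using hdense'
  -- Taking the gap into account lets any `δ`-far pair be added to the pattern `p R` without
  -- violating its gap.
  set δ : ℕ → ℕ := fun R => max (γ R) (p R).gap with hδ
  set ρ : ℕ → ℕ := fun R => ∑ r ∈ Finset.range (R + 1), ((p r).radius + (p r).gap + γ r)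
  refine ⟨n + 1, δ, fun R => ⟨Metric.closedBall x₀ (ρ R), Metric.isBounded_closedBall,
    fun K hK hKρ R' hR' A hA B hB hAB => ?_⟩⟩
  have hρR' : (p R').radius + (p R').gap + γ R' ≤ ρ R :=
    Finset.single_le_sum (f := fun r => (p r).radius + (p r).gap + γ r)
      (fun i _ => Nat.zero_le _) (Finset.mem_range.2 (Nat.lt_succ_of_le hR'))
  have hfar : ∀ x ∈ K, ((p R').radius + (p R').gap + γ R' : ℝ) < dist x x₀ := by
    intro x hx
    have h1 : ¬ dist x x₀ ≤ ρ R := Set.disjoint_left.1 hKρ hx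
    have h2 : (((p R').radius + (p R').gap + γ R' : ℕ) : ℝ) ≤ ρ R := Nat.cast_le.2 hρR'
    push_cast at h2
    linarith
  obtain ⟨σ, hσ⟩ := hK.subset_closedBall x₀
  obtain ⟨N, hN⟩ := exists_nat_gt (max σ (p R').radius)
  have hKN : K ⊆ Metric.closedBall x₀ (N : ℝ) :=
    hσ.trans (Metric.closedBall_subset_closedBall ((le_max_left _ _).trans hN.le))
  have hpN : (p R').radius ≤ N := by
    have := (le_max_right σ ((p R').radius : ℝ)).trans hN.le
    exact_mod_cast this
  have hballN : Metric.closedBall x₀ ((p R').radius : ℝ) ⊆ Metric.closedBall x₀ (N : ℝ) :=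
    Metric.closedBall_subset_closedBall (Nat.cast_le.2 hpN)
  -- `A` and `B` are grafted onto the pattern. Mixed distances exceed the gap because `K` lies
  -- beyond the radius plus the gap.
  let q : PairPattern x₀ :=
    { radius := N
      fst := (p R').fst ∪ A
      snd := (p R').snd ∪ B
      gap := (p R').gap
      fst_subset := Set.union_subset ((p R').fst_subset.trans hballN) (hA.trans hKN)
      snd_subset := Set.union_subset ((p R').snd_subset.trans hballN) (hB.trans hKN) }
  have hnot : ∀ x ∈ K, x ∉ Metric.closedBall x₀ ((p R').radius : ℝ) := by
    intro x hx hxb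
    rw [Metric.mem_closedBall] at hxb
    have := hfar x hx
    have h1 : (0 : ℝ) ≤ (p R').gap := Nat.cast_nonneg _
    have h2 : (0 : ℝ) ≤ γ R' := Nat.cast_nonneg _
    linarith
  have hcross : ∀ x ∈ K, ∀ y ∈ Metric.closedBall x₀ ((p R').radius : ℝ),
      ((p R').gap : ℝ) < dist x y := by
    intro x hx y hy
    rw [Metric.mem_closedBall] at hy
    have := hfar x hx
    have h2 : (0 : ℝ) ≤ γ R' := Nat.cast_nonneg _
    linarith [dist_triangle x y x₀]
  have hq : q.Refines (p R') := by
    refine ⟨hpN, le_rfl, ?_, ?_, ?_⟩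
    · rw [Set.union_inter_distrib_right, Set.inter_eq_self_of_subset_left (p R').fst_subset]
      refine Set.union_eq_self_of_subset_right ?_
      rintro x ⟨hx, hxb⟩
      exact (hnot x (hA hx) hxb).elim
    · rw [Set.union_inter_distrib_right, Set.inter_eq_self_of_subset_left (p R').snd_subset]
      refine Set.union_eq_self_of_subset_right ?_
      rintro x ⟨hx, hxb⟩
      exact (hnot x (hB hx) hxb).elim
    · rintro a (ha | ha) b (hb | hb) hab
      · exact (hab.elim (fun h => h ((p R').fst_subset ha)) fun h => h ((p R').snd_subset hb)).elim
      · rw [dist_comm]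
        exact hcross b (hB hb) a ((p R').fst_subset ha)
      · exact hcross a (hA ha) b ((p R').snd_subset hb)
      · exact lt_of_le_of_lt (Nat.cast_le.2 (le_max_right _ _)) (hAB a ha b hb)
  obtain ⟨A', B', hm, γ', hγ', C, hC, hsep⟩ := hp R' q hq
  rw [hγ' R' le_rfl] at hsep
  have hnot' : ∀ x ∈ K, x ∉ Metric.closedBall x₀ (γ R' : ℝ) := by
    intro x hx hxb
    rw [Metric.mem_closedBall] at hxb
    have := hfar x hx
    have h1 : (0 : ℝ) ≤ (p R').gap := Nat.cast_nonneg _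
    have h2 : (0 : ℝ) ≤ (p R').radius := Nat.cast_nonneg _
    linarith
  have hAA' : A ⊆ A' := fun a ha => by
    have : a ∈ q.fst := Or.inr ha
    rw [← hm.fst_eq] at this
    exact this.1
  have hBB' : B ⊆ B' := fun a ha => by
    have : a ∈ q.snd := Or.inr ha
    rw [← hm.snd_eq] at this
    exact this.1
  set M : ℕ := ∑ r ∈ Finset.range (R' + 1), γ r
  -- The dimension of `C` is controlled on bounded subsets only. The thickening keeps every point of
  -- `C` needed near `K` at scales up to `R'`.
  refine ⟨C ∩ Metric.cthickening M K, ?_, fun r hr => ?_⟩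
  · refine (hC _ Set.inter_subset_left (hK.cthickening.subset Set.inter_subset_right)).mono le_rfl
      (fun r hr => ?_) le_rfl
    rw [hγ' r hr]
    exact le_max_left _ _
  · obtain ⟨U, V, hU, hV, hUV, hcov⟩ := hsep r hr
    refine ⟨U, V, fun a ha => hU ⟨hAA' ha, hnot' a (hA ha)⟩,
      fun b hb => hV ⟨hBB' hb, hnot' b (hB hb)⟩, hUV, fun x hx => ?_⟩
    rcases hcov x (hnot' x hx) with h | h | ⟨c, hc, hd⟩
    · exact Or.inl h
    · exact Or.inr (Or.inl h)
    · rw [hγ' r hr] at hd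
      have hrM : γ r ≤ M := Finset.single_le_sum (f := γ) (fun i _ => Nat.zero_le _)
        (Finset.mem_range.2 (Nat.lt_succ_of_le hr))
      refine Or.inr (Or.inr ⟨c, ⟨hc, Metric.mem_cthickening_of_dist_le c x _ _ hx ?_⟩,
        hd.trans (Nat.cast_le.2 (le_max_left _ _))⟩)
      rw [dist_comm]
      exact hd.trans (Nat.cast_le.2 hrM)

end

/-! ### The transfinite induction -/

open Bornology in
/-- A proper metric space with `trasInd X < ∞` has finite scale dimension far out. -/
lemma TrasIndLE.exists_scaleDimLT {α : Ordinal.{u}} {X : Type u} [MetricSpace X] [ProperSpace X]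
    (h : TrasIndLE α X) : ∃ n γ, ∀ R : ℕ, ∃ D : Set X, IsBounded D ∧
      ∀ K, IsBounded K → Disjoint K D → ScaleDimLT n γ R K := by
  induction α using WellFoundedLT.induction generalizing X with
  | ind α ih =>
    rcases isEmpty_or_nonempty X with hX | ⟨⟨x₀⟩⟩
    · exact ⟨0, 0, fun R => ⟨∅, isBounded_empty, fun K _ _ => Set.eq_empty_of_isEmpty K⟩⟩
    · refine exists_scaleDimLT_of_hasScaleSeparator x₀ fun A B hAB => ?_
      rw [TrasIndLE] at h
      obtain ⟨C, hC, hdim⟩ := h A B hAB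
      have hCp : ProperSpace C := .of_isClosed hC.1
      obtain ⟨n, γ, hγ⟩ : ∃ n γ, ∀ R : ℕ, ∃ D : Set C, IsBounded D ∧
          ∀ K, IsBounded K → Disjoint K D → ScaleDimLT n γ R K := by
        rcases hdim with hb | ⟨β, hβ, hT⟩
        -- For a bounded separator everything is discarded: only the empty set is disjoint from
        -- `Set.univ`.
        · exact ⟨0, 0, fun R => ⟨Set.univ, hb.bounded_univ, fun K _ hK => Set.disjoint_univ.1 hK⟩⟩
        · exact ih β hβ hT
      refine ⟨n, hC.exists_hasScaleSeparator x₀ (γ := γ) fun R => ?_⟩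
      obtain ⟨D, hD, hdim⟩ := hγ R
      refine ⟨(↑) '' D, isometry_subtype_coe.lipschitz.isBounded_image hD, fun K hKC hK hKD => ?_⟩
      have hKeq : ((↑) : C → X) '' ((↑) ⁻¹' K) = K := by
        rw [Subtype.image_preimage_coe, Set.inter_eq_right]
        exact hKC
      rw [← hKeq]
      refine ScaleDimLT.image isometry_subtype_coe (hdim _ ?_ ?_)
      · exact isBounded_image_subtype_val.1 (hKeq.symm ▸ hK)
      · rw [Set.disjoint_left] at hKD ⊢
        exact fun x hx hxD => hKD hx (Set.mem_image_of_mem _ hxD)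

/-! ### Enlarging pairs from coarse to fine scales -/

section
variable {X : Type*} [MetricSpace X]
open Bornology Filter Topology

/-- How close a subset stays to a controlled set at scale `s` after `k` separators were chosen. -/
def nearness (γ : ℕ → ℕ) (s : ℕ) : ℕ → ℕ
  | 0 => 0
  | k + 1 => γ (s + 2 * nearness γ s k) + nearness γ s k

lemma nearness_mono (γ : ℕ → ℕ) (s : ℕ) : Monotone (nearness γ s) :=
  monotone_nat_of_le_succ fun _ => Nat.le_add_left _ _

/-- A scale up to which control is needed in order to choose `N` successive separators at scale
`s`. -/
def controlScale (γ : ℕ → ℕ) (N s : ℕ) : ℕ := s + 2 * nearness γ s N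

/-- A sequence of scales, each of which is large in terms of the previous one. -/
def scaleSeq (γ : ℕ → ℕ) (N : ℕ) : ℕ → ℕ
  | 0 => 0
  | i + 1 => γ (controlScale γ N (scaleSeq γ N i)) + 2 * nearness γ (scaleSeq γ N i) N +
      scaleSeq γ N i + 1

lemma scaleSeq_lt_succ (γ : ℕ → ℕ) (N i : ℕ) : scaleSeq γ N i < scaleSeq γ N (i + 1) := by
  simp only [scaleSeq]
  omega

lemma scaleSeq_strictMono (γ : ℕ → ℕ) (N : ℕ) : StrictMono (scaleSeq γ N) :=
  strictMono_nat_of_lt_succ (scaleSeq_lt_succ γ N)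

lemma scaleDimLT_empty (m : ℕ) (γ : ℕ → ℕ) (R : ℕ) : ScaleDimLT m γ R (∅ : Set X) := by
  induction m with
  | zero => rfl
  | succ m ih => exact ih.succ

/-- At scale `s`, and up to isolated points, the subset `K` of `Z` is close to a subset of `X` of
scale dimension less than `m`. -/
def IsNearControlled {Z : Type*} [MetricSpace Z] (ι : Z → X) (γ : ℕ → ℕ) (N k m s : ℕ)
    (K : Set Z) : Prop :=
  ∃ L ⊆ K, (∀ x ∈ L, ∀ y ∈ K, x ≠ y → (s : ℝ) < dist x y) ∧
    ∃ C : Set X, ScaleDimLT m γ (controlScale γ N s) C ∧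
      ∀ z ∈ K \ L, ∃ c ∈ C, dist (ι z) c ≤ nearness γ s k

/-- For each scale in the sequence `scaleSeq γ N`, finite subsets far out are near a subset of `X`
of scale dimension less than `m`. -/
def AsymptoticallyNearControlled {Z : Type*} [MetricSpace Z] (ι : Z → X) (γ : ℕ → ℕ)
    (N k m : ℕ) : Prop :=
  ∀ i : ℕ, ∃ D : Set Z, IsBounded D ∧ ∀ K : Set Z, K.Finite → Disjoint K D →
    IsNearControlled ι γ N k m (scaleSeq γ N i) K

/-- One step of the construction of a separator: a pair that is far apart at a large scale is
enlarged to a pair that is far apart at a smaller scale, and that covers everything but the points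
near a set of smaller dimension. -/
lemma IsNearControlled.exists_farApart {Z : Type*} [MetricSpace Z] {ι : Z → X} (hι : Isometry ι)
    {γ : ℕ → ℕ} {N k m s s' : ℕ} {K : Set Z} (hK : IsNearControlled ι γ N k (m + 1) s K)
    (hk : k ≤ N) (hs' : γ (controlScale γ N s) + 2 * nearness γ s N ≤ s') {A B : Set Z}
    (hA : A ⊆ K) (hB : B ⊆ K) (hAB : FarApart s' A B) :
    ∃ U V : Set Z, A ⊆ U ∧ B ⊆ V ∧ U ⊆ K ∧ V ⊆ K ∧ FarApart s U V ∧
      ∃ C : Set X, ScaleDimLT m γ (controlScale γ N s) C ∧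
        ∀ z ∈ K, z ∈ U ∨ z ∈ V ∨ ∃ c ∈ C, dist (ι z) c ≤ nearness γ s (k + 1) := by
  obtain ⟨L, hLK, hL, C, hC, hnear⟩ := hK
  rcases isEmpty_or_nonempty X with hX | hX
  · exact ⟨A, B, le_rfl, le_rfl, hA, hB, fun a => (hX.false (ι a)).elim, ∅, scaleDimLT_empty _ _ _,
      fun z => (hX.false (ι z)).elim⟩
  choose! π hπC hπ using hnear
  set T := nearness γ s k with hT
  have hTN : T ≤ nearness γ s N := nearness_mono γ s hk
  have hdist : ∀ z ∈ K \ L, ∀ w ∈ K \ L, dist z w ≤ dist (π z) (π w) + 2 * T ∧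
      dist (π z) (π w) ≤ dist z w + 2 * T := by
    intro z hz w hw
    have h1 := hπ z hz
    have h2 := hπ w hw
    rw [← hι.dist_eq]
    constructor
    · linarith [dist_triangle4_right (ι z) (ι w) (π z) (π w)]
    · linarith [dist_triangle4 (π z) (ι z) (ι w) (π w), dist_comm (ι z) (π z)]
  obtain ⟨C₂, hC₂, hsep⟩ := hC _ le_rfl (π '' (A \ L))
    (by rintro _ ⟨a, ha, rfl⟩; exact hπC a ⟨hA ha.1, ha.2⟩) (π '' (B \ L))
    (by rintro _ ⟨a, ha, rfl⟩; exact hπC a ⟨hB ha.1, ha.2⟩) (by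
      rintro _ ⟨a, ha, rfl⟩ _ ⟨b, hb, rfl⟩
      have h1 := hAB a ha.1 b hb.1
      have h2 := (hdist a ⟨hA ha.1, ha.2⟩ b ⟨hB hb.1, hb.2⟩).1
      have h3 : ((γ (controlScale γ N s) + 2 * T : ℕ) : ℝ) ≤ s' := Nat.cast_le.2 (by omega)
      push_cast at h3
      linarith)
  -- The projection `π` changes distances by at most `2 * T`, so scale `s + 2 * T` in `C` yields
  -- scale `s` in `K`. The resulting nearness `γ (s + 2 * T) + T` is the recursion of `nearness`.
  obtain ⟨U', V', hU', hV', hUV', hcov⟩ := hsep (s + 2 * T) (by unfold controlScale; omega)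
  -- Isolated points can go to either side, as they are `s`-far from all others; they go to `U`
  -- unless they lie in `B`.
  refine ⟨{z | z ∈ K ∧ (z ∈ L → z ∉ B) ∧ (z ∉ L → π z ∈ U')},
    {z | z ∈ K ∧ (z ∈ L → z ∈ B) ∧ (z ∉ L → π z ∈ V')}, ?_, ?_, fun z hz => hz.1,
    fun z hz => hz.1, ?_, C₂, hC₂, ?_⟩
  · exact fun a ha => ⟨hA ha, fun _ => Set.disjoint_left.1 hAB.disjoint ha,
      fun haL => hU' (Set.mem_image_of_mem _ ⟨ha, haL⟩)⟩
  · exact fun b hb => ⟨hB hb, fun _ => hb, fun hbL => hV' (Set.mem_image_of_mem _ ⟨hb, hbL⟩)⟩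
  · rintro u ⟨huK, huL, huU⟩ v ⟨hvK, hvL, hvV⟩
    by_cases hu : u ∈ L
    · refine hL u hu v hvK ?_
      rintro rfl
      exact huL hu (hvL hu)
    · by_cases hv : v ∈ L
      · rw [dist_comm]
        refine hL v hv u huK ?_
        rintro rfl
        exact hu hv
      · have h1 := hUV' _ (huU hu) _ (hvV hv)
        have h2 := (hdist u ⟨huK, hu⟩ v ⟨hvK, hv⟩).2
        push_cast at h1
        linarith
  · intro z hz
    by_cases hzL : z ∈ L
    · by_cases hzB : z ∈ B
      · exact Or.inr (Or.inl ⟨hz, fun _ => hzB, fun h => (h hzL).elim⟩)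
      · exact Or.inl ⟨hz, fun _ => hzB, fun h => (h hzL).elim⟩
    · rcases hcov (π z) (hπC z ⟨hz, hzL⟩) with h | h | ⟨c, hc, hd⟩
      · exact Or.inl ⟨hz, fun h => (hzL h).elim, fun _ => h⟩
      · exact Or.inr (Or.inl ⟨hz, fun h => (hzL h).elim, fun _ => h⟩)
      · refine Or.inr (Or.inr ⟨c, hc, ?_⟩)
        have h1 := hπ z ⟨hz, hzL⟩
        simp only [nearness]
        push_cast
        linarith [dist_triangle (ι z) (π z) c]

/-- Levels are chosen from coarse to fine, so the choice has to start at some finite level `I + 1`;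
an ultralimit in `I` later removes this start. -/
lemma exists_descending {α : Type*} {P : ℕ → α → α → Prop} {Q : ℕ → α → Prop}
    (h : ∀ i y, Q (i + 1) y → ∃ x, Q i x ∧ P i x y) (I : ℕ) (y₀ : α) (hy₀ : Q (I + 1) y₀) :
    ∃ f : ℕ → α, f (I + 1) = y₀ ∧ ∀ i ≤ I, P i (f i) (f (i + 1)) := by
  induction I generalizing y₀ with
  | zero =>
    obtain ⟨x, -, hx⟩ := h 0 y₀ hy₀
    refine ⟨fun i => if i = 0 then x else y₀, by simp, fun i hi => ?_⟩
    obtain rfl := Nat.le_zero.1 hi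
    simpa using hx
  | succ I ih =>
    obtain ⟨x, hQ, hx⟩ := h (I + 1) y₀ hy₀
    obtain ⟨f, hf, hP⟩ := ih x hQ
    refine ⟨fun i => if i ≤ I + 1 then f i else y₀, by simp, fun i hi => ?_⟩
    rcases Nat.le_succ_iff.1 hi with hi | rfl
    · have h1 : i ≤ I + 1 := hi.trans (Nat.le_succ _)
      simpa [h1, hi] using hP i hi
    · simpa [hf] using hx

/-- The part of the `i`-neighbourhood of `A` outside of the ball of radius `ρ` about `x₀`. -/
def fattening (x₀ : X) (A : Set X) (i ρ : ℕ) : Set X :=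
  {z | (ρ : ℝ) < dist z x₀ ∧ ∃ a ∈ A, dist z a ≤ i}

lemma AsymptoticallyDisjoint.exists_farApart_fattening {A B : Set X}
    (h : AsymptoticallyDisjoint A B) (x₀ : X) (i s : ℕ) : ∃ ρ : ℕ, ∀ ρ' ≥ ρ,
      FarApart s (fattening x₀ A i ρ') (fattening x₀ B i ρ') := by
  obtain ⟨m, hm⟩ := h.exists_forall_lt_dist x₀ (s + 2 * i)
  refine ⟨m + i, ?_⟩
  rintro ρ' hρ' z ⟨hz, a, ha, hza⟩ w ⟨-, b, hb, hwb⟩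
  have h0 : ((m + i : ℕ) : ℝ) ≤ ρ' := Nat.cast_le.2 hρ'
  push_cast at h0
  have h1 := hm a ha (by linarith [dist_triangle z a x₀]) b hb
  rw [dist_comm] at hza
  linarith [dist_triangle4 a z w b]

lemma eventually_le_of_atTop {Z : Type*} {l : Ultrafilter (ℕ × Finset Z)}
    (hl : (l : Filter (ℕ × Finset Z)) ≤ atTop) (i : ℕ) {K : Set Z} (hK : K.Finite) :
    ∀ᶠ j in (l : Filter (ℕ × Finset Z)), i ≤ j.1 ∧ K ⊆ j.2 := by
  filter_upwards [hl (eventually_ge_atTop (i, hK.toFinset))] with j hj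
  exact ⟨hj.1, fun x hx => hj.2 (hK.mem_toFinset.2 hx)⟩

/-- The scale by scale construction of a separator. -/
lemma AsymptoticallyNearControlled.exists_levels {Z : Type*} [MetricSpace Z] {ι : Z → X}
    (hι : Isometry ι) {γ : ℕ → ℕ} {N k m : ℕ}
    (hZ : AsymptoticallyNearControlled ι γ N k (m + 1)) (hk : k ≤ N) (x₀ : Z) {A B : Set Z}
    (hAB : AsymptoticallyDisjoint A B) :
    ∃ (U V : ℕ → Set Z) (ρ τ : ℕ → ℕ), (∀ i, FarApart (scaleSeq γ N i) (U i) (V i)) ∧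
      (∀ i, fattening x₀ A i (ρ i) ⊆ U i) ∧ (∀ i, fattening x₀ B i (ρ i) ⊆ V i) ∧
      (∀ i, U (i + 1) \ Metric.closedBall x₀ (τ i) ⊆ U i) ∧
      (∀ i, V (i + 1) \ Metric.closedBall x₀ (τ i) ⊆ V i) ∧
      ∀ i, ∀ K : Set Z, K.Finite → (∀ z ∈ K, (ρ i : ℝ) < dist z x₀ ∧ z ∉ U i ∧ z ∉ V i) →
        ∃ C : Set X, ScaleDimLT m γ (controlScale γ N (scaleSeq γ N i)) C ∧
          ∀ z ∈ K, ∃ c ∈ C, dist (ι z) c ≤ nearness γ (scaleSeq γ N i) (k + 1) := by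
  classical
  choose D hD hDK using hZ
  have hd : ∀ i, ∃ d : ℕ, D i ⊆ Metric.closedBall x₀ d := fun i => by
    obtain ⟨ρ, hρ⟩ := (hD i).subset_closedBall x₀
    obtain ⟨n, hn⟩ := exists_nat_gt ρ
    exact ⟨n, hρ.trans (Metric.closedBall_subset_closedBall hn.le)⟩
  choose d hd using hd
  choose e he using fun i => hAB.exists_farApart_fattening x₀ i (scaleSeq γ N (i + 1))
  set s := scaleSeq γ N with hs
  set ρ : ℕ → ℕ := fun i => d i + e i with hρ
  -- The first two summands separate points beyond `τ i` from those within `ρ (i + 1)`; the last one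
  -- keeps them in the controlled region of level `i`.
  set τ : ℕ → ℕ := fun i => ρ (i + 1) + s (i + 1) + ρ i with hτ
  -- the relation between two successive levels, inside of the finite set `K`
  let P : Set Z → ℕ → Set Z × Set Z → Set Z × Set Z → Prop := fun K i x y =>
    FarApart (s i) x.1 x.2 ∧ fattening x₀ A i (ρ i) ∩ K ⊆ x.1 ∧
    fattening x₀ B i (ρ i) ∩ K ⊆ x.2 ∧ y.1 \ Metric.closedBall x₀ (τ i) ⊆ x.1 ∧
    y.2 \ Metric.closedBall x₀ (τ i) ⊆ x.2 ∧
    ∃ C : Set X, ScaleDimLT m γ (controlScale γ N (s i)) C ∧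
      ∀ z ∈ K, (ρ i : ℝ) < dist z x₀ → z ∈ x.1 ∨ z ∈ x.2 ∨
        ∃ c ∈ C, dist (ι z) c ≤ nearness γ (s i) (k + 1)
  -- The nonemptiness conditions allow the descent to start with the pair `(∅, ∅)`, which need not
  -- contain the fattenings.
  let Q : Set Z → ℕ → Set Z × Set Z → Prop := fun K i x =>
    x.1 ⊆ K ∧ x.2 ⊆ K ∧ FarApart (s i) x.1 x.2 ∧ (x.1.Nonempty → fattening x₀ B i (ρ i) ∩ K ⊆ x.2) ∧
    (x.2.Nonempty → fattening x₀ A i (ρ i) ∩ K ⊆ x.1)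
  have hmixed : ∀ (E : Set Z) (K W W' : Set Z) (i : ℕ), FarApart (s (i + 1)) W W' →
      (W.Nonempty → fattening x₀ E (i + 1) (ρ (i + 1)) ∩ K ⊆ W') →
      FarApart (s (i + 1)) (W \ Metric.closedBall x₀ (τ i)) (fattening x₀ E i (ρ i) ∩ K) := by
    rintro E K W W' i hWW' hE u ⟨huW, hu⟩ b ⟨⟨-, a, ha, hba⟩, hbK⟩
    by_cases hb : (ρ (i + 1) : ℝ) < dist b x₀
    · refine hWW' u huW b (hE ⟨u, huW⟩ ⟨⟨hb, a, ha, hba.trans ?_⟩, hbK⟩)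
      exact Nat.cast_le.2 (Nat.le_succ i)
    · rw [Metric.mem_closedBall, not_le] at hu
      have h1 : ((ρ (i + 1) + s (i + 1) : ℕ) : ℝ) ≤ τ i := Nat.cast_le.2 (by simp [hτ])
      push_cast at h1
      linarith [dist_triangle u b x₀]
  have hstep : ∀ (K : Set Z), K.Finite → ∀ i y, Q K (i + 1) y → ∃ x, Q K i x ∧ P K i x y := by
    rintro K hK i ⟨U', V'⟩ ⟨hU'K, hV'K, hUV', hBV', hAU'⟩
    set K' : Set Z := {z | z ∈ K ∧ (ρ i : ℝ) < dist z x₀} with hK'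
    have hnear : IsNearControlled ι γ N k (m + 1) (s i) K' := by
      refine hDK i K' (hK.subset fun z hz => hz.1) (Set.disjoint_left.2 fun z hz hzD => ?_)
      have h1 := Metric.mem_closedBall.1 (hd i hzD)
      have h2 : (d i : ℝ) ≤ ρ i := Nat.cast_le.2 (Nat.le_add_right _ _)
      linarith [hz.2]
    have hout : ∀ W ⊆ K, W \ Metric.closedBall x₀ (τ i) ⊆ K' := by
      rintro W hW z ⟨hz, hzb⟩
      rw [Metric.mem_closedBall, not_le] at hzb
      have h2 : (ρ i : ℝ) ≤ τ i := Nat.cast_le.2 (Nat.le_add_left _ _)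
      exact ⟨hW hz, by linarith⟩
    have hfat : ∀ E : Set Z, fattening x₀ E i (ρ i) ∩ K ⊆ K' := fun E z hz => ⟨hz.2, hz.1.1⟩
    obtain ⟨U, V, hU, hV, hUK, hVK, hUV, C, hC, hcov⟩ := hnear.exists_farApart hι hk
      (s' := s (i + 1)) (by simp only [hs, scaleSeq]; omega)
      (A := U' \ Metric.closedBall x₀ (τ i) ∪ fattening x₀ A i (ρ i) ∩ K)
      (B := V' \ Metric.closedBall x₀ (τ i) ∪ fattening x₀ B i (ρ i) ∩ K)
      (Set.union_subset (hout U' hU'K) (hfat A)) (Set.union_subset (hout V' hV'K) (hfat B)) (by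
        rintro a (ha | ha) b (hb | hb)
        · exact hUV' a ha.1 b hb.1
        · exact hmixed B K U' V' i hUV' hBV' a ha b hb
        · rw [dist_comm]
          refine hmixed A K V' U' i (fun v hv u hu => ?_) hAU' b hb a ha
          rw [dist_comm]
          exact hUV' u hu v hv
        · exact he i (ρ i) (Nat.le_add_left _ _) a ha.1 b hb.1)
    refine ⟨(U, V), ⟨fun z hz => (hUK hz).1, fun z hz => (hVK hz).1, hUV,
      fun _ => Set.subset_union_right.trans hV, fun _ => Set.subset_union_right.trans hU⟩,
      hUV, Set.subset_union_right.trans hU, Set.subset_union_right.trans hV,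
      Set.subset_union_left.trans hU, Set.subset_union_left.trans hV, C, hC,
      fun z hz hzρ => hcov z ⟨hz, hzρ⟩⟩
  have hfin : ∀ j : ℕ × Finset Z, ∃ f : ℕ → Set Z × Set Z,
      ∀ i ≤ j.1, P (j.2 : Set Z) i (f i) (f (i + 1)) := by
    rintro ⟨I, K⟩
    obtain ⟨f, -, hf⟩ := exists_descending (hstep K K.finite_toSet) I (∅, ∅)
      ⟨Set.empty_subset _, Set.empty_subset _, fun a ha => ha.elim,
        fun h => (Set.not_nonempty_empty h).elim, fun h => (Set.not_nonempty_empty h).elim⟩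
    exact ⟨f, hf⟩
  choose f hf using hfin
  -- The choices for finite data `(I, K)` are glued along an ultrafilter. Each condition on finitely
  -- many points passes to the limit; the sets `C` do not, which is why control is only claimed for
  -- finite subsets.
  obtain ⟨l, hl⟩ : ∃ l : Ultrafilter (ℕ × Finset Z), (l : Filter (ℕ × Finset Z)) ≤ atTop :=
    ⟨Ultrafilter.of atTop, Ultrafilter.of_le _⟩
  have hle : ∀ i, ∀ᶠ j in (l : Filter (ℕ × Finset Z)), P j.2 i (f j i) (f j (i + 1)) := fun i =>
    (eventually_le_of_atTop hl i Set.finite_empty).mono fun j hj => hf j i hj.1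
  have hmem : ∀ z, ∀ᶠ j in (l : Filter (ℕ × Finset Z)), z ∈ j.2 := fun z =>
    (eventually_le_of_atTop hl 0 (Set.finite_singleton z)).mono fun j hj => hj.2 rfl
  refine ⟨fun i => {z | ∀ᶠ j in (l : Filter (ℕ × Finset Z)), z ∈ (f j i).1},
    fun i => {z | ∀ᶠ j in (l : Filter (ℕ × Finset Z)), z ∈ (f j i).2}, ρ, τ,
    fun i a ha b hb => ?_, fun i z hz => ?_, fun i z hz => ?_, fun i z hz => ?_, fun i z hz => ?_,
    fun i K hK hKz => ?_⟩
  · obtain ⟨j, h1, h2, h3⟩ := ((hle i).and (ha.and hb)).exists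
    exact h1.1 a h2 b h3
  · filter_upwards [hle i, hmem z] with j h1 h2
    exact h1.2.1 ⟨hz, h2⟩
  · filter_upwards [hle i, hmem z] with j h1 h2
    exact h1.2.2.1 ⟨hz, h2⟩
  · filter_upwards [hle i, hz.1] with j h1 h2
    exact h1.2.2.2.1 ⟨h2, hz.2⟩
  · filter_upwards [hle i, hz.1] with j h1 h2
    exact h1.2.2.2.2.1 ⟨h2, hz.2⟩
  · have h1 : ∀ᶠ j in (l : Filter (ℕ × Finset Z)), ∀ z ∈ K, z ∉ (f j i).1 ∧ z ∉ (f j i).2 := by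
      rw [eventually_all_finite hK]
      exact fun z hz => (Ultrafilter.eventually_not.2 (hKz z hz).2.1).and
        (Ultrafilter.eventually_not.2 (hKz z hz).2.2)
    obtain ⟨j, h1, h2, h3⟩ := (h1.and ((hle i).and (eventually_le_of_atTop hl 0 hK))).exists
    obtain ⟨-, -, -, -, -, C, hC, hcov⟩ := h2
    refine ⟨C, hC, fun z hz => ?_⟩
    exact ((hcov z (h3.2 hz) (hKz z hz).1).resolve_left (h1 z hz).1).resolve_left (h1 z hz).2

end

/-! ### Sparse nets as separators -/

section
variable {X : Type*} [MetricSpace X]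
open Bornology Filter Topology

/-- A maximal `D`-separated subset of the points of `S` at a distance larger than `D` from `T`. -/
lemma exists_separated_net {D : ℝ} (hD : 0 ≤ D) (S T : Set X) : ∃ M ⊆ S,
    (∀ x ∈ M, ∀ y ∈ M, x ≠ y → D < dist x y) ∧ (∀ x ∈ M, ∀ y ∈ T, D < dist x y) ∧
    ∀ x ∈ S, ∃ y ∈ T ∪ M, dist x y ≤ D := by
  obtain ⟨M, hM⟩ := zorn_subset {M : Set X | M ⊆ S ∧ (∀ x ∈ M, ∀ y ∈ M, x ≠ y → D < dist x y) ∧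
    ∀ x ∈ M, ∀ y ∈ T, D < dist x y} (by
      intro c hc hchain
      refine ⟨⋃₀ c, ⟨Set.sUnion_subset fun s hs => (hc hs).1, ?_, ?_⟩,
        fun s hs => Set.subset_sUnion_of_mem hs⟩
      · rintro x ⟨s, hs, hx⟩ y ⟨t, ht, hy⟩ hxy
        rcases hchain.total hs ht with hst | hts
        · exact (hc ht).2.1 x (hst hx) y hy hxy
        · exact (hc hs).2.1 x hx y (hts hy) hxy
      · rintro x ⟨s, hs, hx⟩ y hy
        exact (hc hs).2.2 x hx y hy)
  refine ⟨M, hM.prop.1, hM.prop.2.1, hM.prop.2.2, fun x hx => ?_⟩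
  by_contra! hcon
  have hins : insert x M ⊆ M := by
    refine hM.le_of_ge ⟨Set.insert_subset hx hM.prop.1, ?_, ?_⟩ (Set.subset_insert x M)
    · rintro a (rfl | ha) b (rfl | hb) hab
      · exact (hab rfl).elim
      · exact hcon b (Or.inr hb)
      · rw [dist_comm]
        exact hcon a (Or.inr ha)
      · exact hM.prop.2.1 a ha b hb hab
    · rintro a (rfl | ha) b hb
      · exact hcon b (Or.inl hb)
      · exact hM.prop.2.2 a ha b hb
  have := hcon x (Or.inr (hins (Set.mem_insert x M)))
  rw [dist_self] at this
  exact absurd this (not_lt.2 hD)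

/-- Successive nets in a sequence of sets, which get sparser and sparser. -/
lemma exists_net_seq {D : ℕ → ℝ} (hD : ∀ i, 0 ≤ D i) (hmono : Monotone D) (S : ℕ → Set X) :
    ∃ G : ℕ → Set X, G 0 = ∅ ∧ Monotone G ∧ (∀ i, G (i + 1) ⊆ G i ∪ S i) ∧
      (∀ i, ∀ x ∈ S i, ∃ y ∈ G (i + 1), dist x y ≤ D i) ∧
      ∀ i, ∀ x ∈ (⋃ j, G j) \ G i, ∀ y ∈ ⋃ j, G j, x ≠ y → D i < dist x y := by
  choose M hMS hMM hMT hcov using fun (i : ℕ) (T : Set X) => exists_separated_net (hD i) (S i) T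
  let G : ℕ → Set X := fun j => Nat.rec ∅ (fun i T => T ∪ M i T) j
  have hG : ∀ i, G (i + 1) = G i ∪ M i (G i) := fun _ => rfl
  have hGm : Monotone G := monotone_nat_of_le_succ fun i => by
    rw [hG]
    exact Set.subset_union_left
  have hstage : ∀ x ∈ ⋃ j, G j, ∃ j, x ∈ M j (G j) := by
    intro x hx
    obtain ⟨j, hj⟩ := Set.mem_iUnion.1 hx
    induction j with
    | zero => exact hj.elim
    | succ j ih =>
      rw [hG] at hj
      exact hj.elim ih fun h => ⟨j, h⟩
  -- The stage of the later point governs the distance, since each new point avoids the whole net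
  -- built before.
  have hlt : ∀ j j', j ≤ j' → ∀ x ∈ M j (G j), ∀ y ∈ M j' (G j'), x ≠ y → D j' < dist y x := by
    intro j j' hjj' x hx y hy hxy
    rcases hjj'.eq_or_lt with rfl | hlt
    · exact hMM j _ y hy x hx hxy.symm
    · refine hMT j' _ y hy x (hGm (Nat.succ_le_of_lt hlt) ?_)
      rw [Nat.succ_eq_add_one, hG]
      exact Or.inr hx
  refine ⟨G, rfl, hGm, fun i => ?_, fun i x hx => ?_, ?_⟩
  · rw [hG]
    exact Set.union_subset_union_right _ (hMS i _)
  · rw [hG]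
    exact hcov i _ x hx
  · rintro i x ⟨hx, hxi⟩ y hy hxy
    obtain ⟨j, hj⟩ := hstage x hx
    obtain ⟨j', hj'⟩ := hstage y hy
    have hij : i ≤ j := by
      by_contra hlt
      refine hxi (hGm (Nat.succ_le_of_lt (not_le.1 hlt)) ?_)
      rw [Nat.succ_eq_add_one, hG]
      exact Or.inr hj
    rcases le_total j j' with h | h
    · rw [dist_comm]
      exact (hmono (hij.trans h)).trans_lt (hlt j j' h x hj y hj' hxy)
    · exact (hmono hij).trans_lt (hlt j' j h y hj' x hj hxy.symm)

/-- `F` is a net in the points left uncovered at the various levels. Far out the levels are nested,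
so points of `F` from stages up to `i` are uncovered at level `i` and hence near a set of smaller
dimension, while later points are isolated at scale `s i`. -/
lemma AsymptoticallyNearControlled.exists_separator_of_nonempty {Z : Type*} [MetricSpace Z]
    [ProperSpace Z] {ι : Z → X} (hι : Isometry ι) {γ : ℕ → ℕ} {N k m : ℕ}
    (hZ : AsymptoticallyNearControlled ι γ N k (m + 1)) (hk : k ≤ N) (x₀ : Z) {A B : Set Z}
    (hAB : AsymptoticallyDisjoint A B) :
    ∃ F : Set Z, IsAsymptoticSeparator A B F ∧
      AsymptoticallyNearControlled (fun z : F => ι z) γ N (k + 1) m ∧ (m = 0 → F = ∅) := by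
  obtain ⟨U, V, ρ, τ, hUV, hA, hB, hU, hV, hdim⟩ := hZ.exists_levels hι hk x₀ hAB
  set s := scaleSeq γ N with hs
  have hsmono : StrictMono s := scaleSeq_strictMono γ N
  set S : ℕ → Set Z := fun i => {z | (ρ i : ℝ) < dist z x₀ ∧ z ∉ U i ∧ z ∉ V i} with hS
  -- As `s 0 = 0`, the summand 1 makes `F` uniformly discrete, hence closed.
  set D : ℕ → ℝ := fun i => s i + 1 with hD
  have hD0 : ∀ i, 0 ≤ D i := fun i => by positivity
  have hDm : Monotone D := fun i j hij => by
    have : (s i : ℝ) ≤ s j := Nat.cast_le.2 (hsmono.monotone hij)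
    simp only [hD]
    linarith
  obtain ⟨G, hG0, hGm, hGS, hnet, hsep⟩ := exists_net_seq hD0 hDm S
  set F : Set Z := ⋃ j, G j with hF
  have hFS : ∀ j, ∀ x ∈ G j, ∃ i < j, x ∈ S i := by
    intro j
    induction j with
    | zero => intro x hx; rw [hG0] at hx; exact hx.elim
    | succ j ih =>
      intro x hx
      rcases hGS j hx with h | h
      · obtain ⟨i, hi, hx⟩ := ih x h
        exact ⟨i, hi.trans (Nat.lt_succ_self j), hx⟩
      · exact ⟨j, Nat.lt_succ_self j, h⟩
  set θ : ℕ → ℕ := fun i => ∑ j ∈ Finset.range (i + 1), (ρ j + τ j) with hθ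
  have hθle : ∀ i, ∀ j ≤ i, ρ j + τ j ≤ θ i := fun i j hj =>
    Finset.single_le_sum (f := fun j => ρ j + τ j) (fun _ _ => Nat.zero_le _)
      (Finset.mem_range.2 (Nat.lt_succ_of_le hj))
  have hρlt : ∀ i, ∀ j ≤ i, ∀ z, (θ i : ℝ) < dist z x₀ → (ρ j : ℝ) < dist z x₀ := by
    intro i j hj z hz
    exact lt_of_le_of_lt (Nat.cast_le.2 ((Nat.le_add_right _ _).trans (hθle i j hj))) hz
  have hτlt : ∀ i, ∀ j ≤ i, ∀ z, (θ i : ℝ) < dist z x₀ → z ∉ Metric.closedBall x₀ (τ j : ℝ) := by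
    intro i j hj z hz
    rw [Metric.mem_closedBall, not_le]
    exact lt_of_le_of_lt (Nat.cast_le.2 ((Nat.le_add_left _ _).trans (hθle i j hj))) hz
  have hnest : ∀ W : ℕ → Set Z, (∀ i, W (i + 1) \ Metric.closedBall x₀ (τ i) ⊆ W i) →
      ∀ i z, (θ i : ℝ) < dist z x₀ → ∀ j, ∀ j' ≤ i, j ≤ j' → z ∈ W j' → z ∈ W j := by
    intro W hW i z hz j j' hj' hjj' hzW
    induction j', hjj' using Nat.le_induction with
    | base => exact hzW
    | succ n hn ih =>
      exact ih (Nat.le_of_succ_le hj') (hW n ⟨hzW, hτlt i n (Nat.le_of_succ_le hj') z hz⟩)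
  have hnat : ∀ i : ℕ, (i : ℝ) ≤ s i := fun i => Nat.cast_le.2 hsmono.le_apply
  have hclosed : IsClosed F := by
    refine Metric.isClosed_of_pairwise_le_dist (ε := 1) one_pos fun x hx y hy hxy => ?_
    have := hsep 0 x ⟨hx, by rw [hG0]; exact Set.notMem_empty x⟩ y hy hxy
    have h1 : 1 ≤ D 0 := by simp [hD]
    linarith
  have hfar : ∀ (E : Set Z) (W : ℕ → Set Z), (∀ i, fattening x₀ E i (ρ i) ⊆ W i) →
      (∀ i, W (i + 1) \ Metric.closedBall x₀ (τ i) ⊆ W i) → (∀ i, ∀ z ∈ S i, z ∉ W i) →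
      AsymptoticallyDisjoint E F := by
    intro E W hE hW hSW M
    obtain ⟨r, hr⟩ := exists_nat_gt M
    refine ⟨Metric.closedBall x₀ (θ r), Metric.isBounded_closedBall, ?_⟩
    rintro a ⟨ha, -⟩ f ⟨hf, hfb⟩
    by_contra! hlt
    rw [Metric.mem_closedBall, not_le] at hfb
    obtain ⟨j, hj⟩ := Set.mem_iUnion.1 hf
    obtain ⟨i, -, hi⟩ := hFS j f hj
    have hd : dist f a ≤ r := by rw [dist_comm]; linarith
    refine hSW i f hi ?_
    -- A point of `F` within `r` of `E` would be covered at its own level: directly by the fattening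
    -- if `r ≤ i`, and through level `r` and nesting otherwise.
    rcases le_total r i with hri | hir
    · exact hE i ⟨hi.1, a, ha, hd.trans (Nat.cast_le.2 hri)⟩
    · exact hnest W hW r f hfb i r le_rfl hir (hE r ⟨hρlt r r le_rfl f hfb, a, ha, hd⟩)
  have hself : ∀ (E : Set Z) (W : ℕ → Set Z), (∀ i, fattening x₀ E i (ρ i) ⊆ W i) →
      E \ Metric.closedBall x₀ (ρ 0) ⊆ W 0 := by
    rintro E W hE a ⟨ha, hab⟩
    rw [Metric.mem_closedBall, not_le] at hab
    exact hE 0 ⟨hab, a, ha, by simp⟩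
  refine ⟨F, isAsymptoticSeparator_of_crossing (U := U 0) (V := (U 0)ᶜ) hclosed
    (Set.union_compl_self _) ?_ (hfar A U hA hU fun i z hz => hz.2.1)
    (hfar B V hB hV fun i z hz => hz.2.2)
    ⟨_, Metric.isBounded_closedBall, hself A U hA⟩
    ⟨_, Metric.isBounded_closedBall, (hself B V hB).trans
      fun z hz hzU => Set.disjoint_left.1 (hUV 0).disjoint hzU hz⟩, ?_, ?_⟩
  · intro r
    obtain ⟨i, hi⟩ := exists_nat_gt r
    refine ⟨Metric.closedBall x₀ (θ i), Metric.isBounded_closedBall, D i + r, ?_⟩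
    rintro u ⟨hu, hub⟩ v ⟨hv, hvb⟩ huv
    rw [Metric.mem_closedBall, not_le] at hub hvb
    have huV : u ∉ V i := fun h => Set.disjoint_left.1 (hUV 0).disjoint hu
      (hnest V hV i u hub 0 i le_rfl (Nat.zero_le _) h)
    have hvU : v ∉ U i := fun h => hv (hnest U hU i v hvb 0 i le_rfl (Nat.zero_le _) h)
    have h0 : (0 : ℝ) ≤ dist u v := dist_nonneg
    -- A step shorter than `s i` cannot go from `U i` to `V i`, so `u` or `v` is uncovered at level
    -- `i` and hence within `D i` of the net.
    by_cases huU : u ∈ U i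
    · have hvV : v ∉ V i := fun h => by
        have := hUV i u huU v h
        linarith [hnat i]
      obtain ⟨f, hf, hd⟩ := hnet i v ⟨hρlt i i le_rfl v hvb, hvU, hvV⟩
      exact ⟨f, Set.mem_iUnion_of_mem _ hf, by linarith [dist_triangle u v f]⟩
    · obtain ⟨f, hf, hd⟩ := hnet i u ⟨hρlt i i le_rfl u hub, huU, huV⟩
      exact ⟨f, Set.mem_iUnion_of_mem _ hf, by linarith⟩
  · intro i
    refine ⟨(↑) ⁻¹' Metric.closedBall x₀ (θ i), ?_, fun K hK hKD => ?_⟩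
    · exact isBounded_image_subtype_val.1
        (Metric.isBounded_closedBall.subset (Set.image_preimage_subset _ _))
    · obtain ⟨C, hC, hnear⟩ := hdim i ((↑) '' {z : F | z ∈ K ∧ (z : Z) ∈ G (i + 1)})
        ((hK.subset fun z hz => hz.1).image _) (by
          rintro _ ⟨z, ⟨hzK, hzG⟩, rfl⟩
          have hzb : ¬ dist (z : Z) x₀ ≤ θ i := Set.disjoint_left.1 hKD hzK
          rw [not_le] at hzb
          obtain ⟨j, hj, hzS⟩ := hFS _ _ hzG
          have hji : j ≤ i := Nat.lt_succ_iff.1 hj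
          exact ⟨hρlt i i le_rfl z hzb, fun h => hzS.2.1 (hnest U hU i z hzb j i le_rfl hji h),
            fun h => hzS.2.2 (hnest V hV i z hzb j i le_rfl hji h)⟩)
      refine ⟨{z | z ∈ K ∧ (z : Z) ∉ G (i + 1)}, fun z hz => hz.1, ?_, C, hC, ?_⟩
      · intro x hx y hy hxy
        have h1 := hsep (i + 1) x ⟨x.2, hx.2⟩ y y.2 fun h => hxy (Subtype.ext h)
        have h2 : (s i : ℝ) ≤ s (i + 1) := Nat.cast_le.2 (hsmono.monotone (Nat.le_succ i))
        rw [Subtype.dist_eq]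
        change (s (i + 1) : ℝ) + 1 < _ at h1
        linarith
      · rintro z ⟨hzK, hz⟩
        refine hnear z ⟨z, ⟨hzK, ?_⟩, rfl⟩
        by_contra hzG
        exact hz ⟨hzK, hzG⟩
  · rintro rfl
    refine Set.eq_empty_of_forall_notMem fun f hf => ?_
    obtain ⟨j, hj⟩ := Set.mem_iUnion.1 hf
    obtain ⟨i, -, hi⟩ := hFS j f hj
    obtain ⟨C, hC, hnear⟩ := hdim i {f} (Set.finite_singleton f) (by rintro z rfl; exact hi)
    obtain ⟨c, hc, -⟩ := hnear f rfl
    have hC : C = ∅ := hC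
    rw [hC] at hc
    exact hc.elim

lemma AsymptoticallyNearControlled.exists_separator {Z : Type*} [MetricSpace Z]
    [ProperSpace Z] {ι : Z → X} (hι : Isometry ι) {γ : ℕ → ℕ} {N k m : ℕ}
    (hZ : AsymptoticallyNearControlled ι γ N k (m + 1)) (hk : k ≤ N) {A B : Set Z}
    (hAB : AsymptoticallyDisjoint A B) :
    ∃ F : Set Z, IsAsymptoticSeparator A B F ∧
      AsymptoticallyNearControlled (fun z : F => ι z) γ N (k + 1) m ∧ (m = 0 → F = ∅) := by
  rcases isEmpty_or_nonempty Z with hE | ⟨⟨x₀⟩⟩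
  · refine ⟨∅, isAsymptoticSeparator_of_crossing (U := ∅) (V := ∅) isClosed_empty
      (Set.eq_univ_of_forall fun z => (hE.false z).elim)
      (fun r => ⟨∅, isBounded_empty, 0, fun u hu => hu.1.elim⟩)
      (fun M => ⟨∅, isBounded_empty, fun a => (hE.false a).elim⟩)
      (fun M => ⟨∅, isBounded_empty, fun a => (hE.false a).elim⟩)
      ⟨∅, isBounded_empty, fun a => (hE.false a).elim⟩
      ⟨∅, isBounded_empty, fun a => (hE.false a).elim⟩, fun i => ⟨∅, isBounded_empty, fun K _ _ => ?_⟩,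
      fun _ => rfl⟩
    exact ⟨∅, Set.empty_subset _, fun x hx => hx.elim, ∅, scaleDimLT_empty _ _ _,
      fun z => z.2.elim⟩
  · exact hZ.exists_separator_of_nonempty hι hk x₀ hAB

end

/-! ### Induction on the dimension and conclusion -/

/-- A proper metric space which is near a set of scale dimension at most `m` at all scales has
asymptotic large inductive dimension at most `m`. -/
lemma AsymptoticallyNearControlled.asIndLE {X : Type*} [MetricSpace X] {γ : ℕ → ℕ} {N m : ℕ} :
    ∀ {k : ℕ} {Z : Type u} [MetricSpace Z] [ProperSpace Z] {ι : Z → X}, Isometry ι →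
      AsymptoticallyNearControlled ι γ N k (m + 1) → k + m ≤ N → AsIndLE m Z := by
  induction m with
  | zero =>
    intro k Z _ _ ι hι hZ hk A B hAB
    obtain ⟨F, hF, -, h0⟩ := hZ.exists_separator hι hk hAB
    obtain rfl := h0 rfl
    exact ⟨∅, hF, ⟨Set.eq_empty_of_isEmpty (Set.univ : Set (∅ : Set Z)) ▸
      Bornology.isBounded_empty⟩⟩
  | succ m ih =>
    intro k Z _ _ ι hι hZ hk A B hAB
    -- Passing to `F` raises `k` and lowers `m`, so `k + m ≤ N` persists. The controlled sets stay
    -- in the original `X`, whence the isometry `ι`.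
    obtain ⟨F, hF, hFZ, -⟩ := hZ.exists_separator hι (by omega) hAB
    have : ProperSpace F := .of_isClosed hF.1
    exact ⟨F, hF, ih (hι.comp isometry_subtype_coe) hFZ (by omega)⟩

theorem theorem5 (X : Type u) [MetricSpace X] [ProperSpace X] (hX : trasInd X < ⊤) :
    asInd X < ⊤ := by
  unfold asInd
  split_ifs with hb
  · exact bot_lt_top
  obtain ⟨α, hα⟩ : ∃ α, TrasIndLE α X := by
    by_contra! hcon
    have hempty : {d : WithTop Ordinal.{u} | ∃ α : Ordinal.{u}, d = (α : WithTop Ordinal.{u}) ∧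
        TrasIndLE α X} = ∅ := Set.eq_empty_of_forall_notMem fun d ⟨α, _, h⟩ => hcon α h
    rw [trasInd, if_neg hb, hempty, WithTop.sInf_empty] at hX
    exact lt_irrefl _ hX
  obtain ⟨n, γ, hdim⟩ := hα.exists_scaleDimLT
  -- Initially each finite set is its own controlled set, with no isolated points and nearness 0.
  -- Weakening `n` to `n + 1` supplies the successor form that
  -- `AsymptoticallyNearControlled.asIndLE` needs, even for `n = 0`.
  have hnear : AsymptoticallyNearControlled (id : X → X) γ n 0 (n + 1) := fun i => by
    obtain ⟨D, hD, hK⟩ := hdim (controlScale γ n (scaleSeq γ n i))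
    refine ⟨D, hD, fun K hKf hKD => ⟨∅, Set.empty_subset _, fun x hx => hx.elim, K,
      (hK K hKf.isBounded hKD).succ, fun z hz => ⟨z, hz.1, ?_⟩⟩⟩
    simp [nearness]
  have hind : AsIndLE n X := hnear.asIndLE isometry_id (by omega)
  rw [← WithBot.coe_top, WithBot.coe_lt_coe]
  have hmem : (n : WithTop ℕ) ∈ {d : WithTop ℕ | ∃ n : ℕ, d = n ∧ AsIndLE n X} :=
    ⟨n, rfl, hind⟩
  exact (csInf_le' hmem).trans_lt (WithTop.coe_lt_top n)
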